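/- Let $(R,\mathfrak m)$ be a Noetherian local ring of dimension $n$ whose maximal ideal has Samuel multiplicity $e(\mathfrak m)=1$ (for instance, a regular local ring such as $\mathcal O_n=\mathbb C\{x_1,\dots,x_n\}$), and let $I$ be an $\mathfrak m$-primary ideal of $R$. Notation. $e(I)$ is the Samuel multiplicity of $I$. For $\mathfrak m$-primary ideals $I_1,\dots,I_n$, the mixed multiplicity $e(I_1,\dots,I_n)$ is the coefficient of $k_1k_2\cdots k_n$ in the polynomial that gives $\operatorname{length}(R/I_1^{k_1}\cdots I_n^{k_n})$ for all large $k_1,\dots,k_n$. For $0\le i\le n$ put $e_i(I)=e(I,\dots,I,\mathfrak m,\dots,\mathfrak m)$, with $I$ repeated $i$ times and $\mathfrak m$ repeated $n-i$ times. Put $\sigma(I_1,\dots,I_n)=\max_{r\ge 1}e(I_1+\mathfrak m^r,\dots,I_n+\mathfrak m^r)$, let $r(I_1,\dots,I_n)$ be the least integer $r\ge 1$ with $\sigma(I_1,\dots,I_n)=e(I_1+\mathfrak m^r,\dots,I_n+\mathfrak m^r)$, and let $$\mathcal L_0(I_1,\dots,I_n)=\inf_{s\ge 1}\frac{r(I_1^s,\dots,I_n^s)}{s}.$$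 For $1\le i\le n$ put $\mathcal L_0^{(i)}(I)=\mathcal L_0(I,\dots,I,\mathfrak m,\dots,\mathfrak m)$, with $I$ repeated $i$ times and $\mathfrak m$ repeated $n-i$ times. Finally let $$\mathrm{Li}(I)=\sum_{i=1}^n\frac1{\mathcal L_0^{(i)}(I)},\qquad \mathrm{DP}(I)=\frac1{e_1(I)}+\frac{e_1(I)}{e_2(I)}+\cdots+\frac{e_{n-1}(I)}{e_n(I)},$$ and call $I$ a Hickel ideal if $e(I)=\mathcal L_0^{(1)}(I)\cdots\mathcal L_0^{(n)}(I)$. Then $\mathrm{Li}(I)\le \mathrm{DP}(I)$. Moreover, the following conditions are equivalent: (a) $\mathrm{Li}(I)=\mathrm{DP}(I)$; (b) $\mathcal L_0^{(i)}(I)=\dfrac{e_i(I)}{e_{i-1}(I)}$ for all $i=1,\dots,n$; (c) $e_{i-1}(I)^{i}\,e_i(I)=e_i\big(I^{e_{i-1}(I)}+\mathfrak m^{e_i(I)}\big)$ for all $i=1,\dots,n$; (d) $I$ is a Hickel ideal. -/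

import Mathlib

open IsLocalRing

noncomputable section

namespace MixedLoj

variable {R : Type*} [CommRing R]

/-- `P` is a Hilbert-Samuel polynomial of `I`:
`P(k) = length (R / I ^ k)` for all sufficiently large `k`. -/
def IsSamuelPolynomial (I : Ideal R) (P : Polynomial ℚ) : Prop :=
  ∃ N : ℕ, ∀ k : ℕ, N ≤ k →
    P.eval (k : ℚ) = ((Module.length R (R ⧸ I ^ k)).toNat : ℚ)

/-- The Samuel multiplicity `e(I)` of an ideal `I` of finite colength in a Noetherian local ring
of dimension `n`: `n!` times the coefficient of degree `n` of the Hilbert-Samuel polynomial.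
The set below has exactly one element in that situation. -/
def samuelMultiplicity (n : ℕ) (I : Ideal R) : ℕ :=
  sInf {e : ℕ | ∃ P : Polynomial ℚ, IsSamuelPolynomial I P ∧
    (n.factorial : ℚ) * P.coeff n = (e : ℚ)}

/-- `P` is a (multigraded) Hilbert polynomial of the ideals `I₁, …, Iₙ`:
`P(k₁, …, kₙ) = length (R / I₁ ^ k₁ ⋯ Iₙ ^ kₙ)` whenever all `kⱼ` are sufficiently large. -/
def IsMixedHilbertPolynomial {n : ℕ} (I : Fin n → Ideal R) (P : MvPolynomial (Fin n) ℚ) : Prop :=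
  ∃ N : ℕ, ∀ k : Fin n → ℕ, (∀ j, N ≤ k j) →
    MvPolynomial.eval (fun j => (k j : ℚ)) P
      = ((Module.length R (R ⧸ ∏ j, I j ^ k j)).toNat : ℚ)

/-- The mixed multiplicity `e(I₁, …, Iₙ)` of ideals of finite colength in a Noetherian
local ring of dimension `n`: the coefficient of `k₁ k₂ ⋯ kₙ` in the Hilbert polynomial of
`I₁, …, Iₙ`. The set below has exactly one element in that situation. -/
def mixedMultiplicity {n : ℕ} (I : Fin n → Ideal R) : ℕ :=
  sInf {e : ℕ | ∃ P : MvPolynomial (Fin n) ℚ, IsMixedHilbertPolynomial I P ∧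
    P.coeff (Finsupp.equivFunOnFinite.symm (fun _ => 1)) = (e : ℚ)}

variable [IsLocalRing R]

/-- The tuple `(I, …, I, 𝔪, …, 𝔪)` of length `n`, with `I` repeated `i` times. -/
def mixedTuple (n i : ℕ) (I : Ideal R) : Fin n → Ideal R :=
  fun j => if (j : ℕ) < i then I else maximalIdeal R

/-- `e_i(I) = e(I, …, I, 𝔪, …, 𝔪)`, with `I` repeated `i` times and `𝔪` repeated `n - i` times. -/
def mixedMult (n i : ℕ) (I : Ideal R) : ℕ :=
  mixedMultiplicity (mixedTuple n i I)

/-- Rees' mixed multiplicity `σ(I₁, …, Iₙ) = max_{r ≥ 1} e(I₁ + 𝔪 ^ r, …, Iₙ + 𝔪 ^ r)`,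
with the value `⊤` if these numbers are unbounded. -/
def reesMixedMultiplicity {n : ℕ} (I : Fin n → Ideal R) : ℕ∞ :=
  ⨆ r : ℕ+, (mixedMultiplicity (fun j => I j + maximalIdeal R ^ (r : ℕ)) : ℕ∞)

/-- `r(I₁, …, Iₙ)`: the least `r ≥ 1` with
`σ(I₁, …, Iₙ) = e(I₁ + 𝔪 ^ r, …, Iₙ + 𝔪 ^ r)` (for `σ(I₁, …, Iₙ) < ∞`). -/
def rNumber {n : ℕ} (I : Fin n → Ideal R) : ℕ :=
  sInf {r : ℕ | 1 ≤ r ∧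
    reesMixedMultiplicity I = (mixedMultiplicity (fun j => I j + maximalIdeal R ^ r) : ℕ∞)}

/-- The Łojasiewicz exponent of `I₁, …, Iₙ`:
the infimum over `s ≥ 1` of `r(I₁ ^ s, …, Iₙ ^ s) / s`. -/
def lojExponent {n : ℕ} (I : Fin n → Ideal R) : ℝ :=
  ⨅ s : ℕ+, (rNumber (fun j => I j ^ (s : ℕ)) : ℝ) / ((s : ℕ) : ℝ)

/-- `𝓛₀⁽ⁱ⁾(I)`: the Łojasiewicz exponent of `(I, …, I, 𝔪, …, 𝔪)`, with `I` repeated `i` times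
and `𝔪` repeated `n - i` times. -/
def lojExp (n i : ℕ) (I : Ideal R) : ℝ :=
  lojExponent (mixedTuple n i I)

/-- `Li(I) = ∑_{i=1}^n 1 / 𝓛₀⁽ⁱ⁾(I)`. -/
def Li (n : ℕ) (I : Ideal R) : ℝ :=
  ∑ i ∈ Finset.Icc 1 n, 1 / lojExp n i I

/-- The Demailly-Pham number
`DP(I) = 1 / e₁(I) + e₁(I) / e₂(I) + ⋯ + e_{n-1}(I) / e_n(I)`; the numerator of the first
summand is `1`. -/
def DP (n : ℕ) (I : Ideal R) : ℝ :=
  ∑ i ∈ Finset.Icc 1 n,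
    (if i = 1 then (1 : ℝ) else (mixedMult n (i - 1) I : ℝ)) / (mixedMult n i I : ℝ)

/-- `I` is a Hickel ideal (has maximal multiplicity): `e(I) = 𝓛₀⁽¹⁾(I) ⋯ 𝓛₀⁽ⁿ⁾(I)`. -/
def IsHickel (n : ℕ) (I : Ideal R) : Prop :=
  (samuelMultiplicity n I : ℝ) = ∏ i ∈ Finset.Icc 1 n, lojExp n i I

end MixedLoj

end

/-! Write `e_i` for `e_i(I)`. Two properties of mixed multiplicities do the work: they decrease when
the ideals grow (`mixedMultiplicity_anti`), and they are multihomogeneous in powers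
(`mixedMultiplicity_pow`). Since `e_0 = e(𝔪) = 1`, all `e_i` are positive.

Let `r = r(I^s, …, I^s, 𝔪^s, …, 𝔪^s)` with `i+1` copies of `I^s`. Adding `𝔪^r` to every entry keeps
the multiplicity `s^n e_{i+1}`. The tuple with `i` copies of `I^s`, one `𝔪^r` and otherwise `𝔪^s` is
entrywise smaller and has multiplicity `r s^{n-1} e_i`. Hence `e_{i+1}/e_i ≤ r/s`, and the infimum
over `s` gives `e_{i+1}/e_i ≤ 𝓛₀⁽ⁱ⁺¹⁾` (`div_le_lojExp`). Summing reciprocals gives `Li ≤ DP`, with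
equality exactly when every one of these inequalities is an equality. The ratios multiply to `e_n =
e(I)`, so the Hickel condition is the same termwise equality.

For (b) ⇔ (c) put `a = e_i`, `b = e_{i+1}`, `E = e_{i+1}(I^a + 𝔪^b)`; monotonicity gives `E ≤
a^{i+1} b`. If equality holds, `s = a` has `r ≤ b`, so the exponent is at most `b/a`
(`lojExp_eq_of_mixedMult_eq`). Conversely, `b/a ≤ r/s` makes large powers of `I^a + 𝔪^b` lie in
almost the expected powers of `I^s + 𝔪^r`. Asymptotically this gives `b^{i+1} b ≤ (r/s)^{i+1} E`;
the inequality passes to the infimum, where `𝓛₀⁽ⁱ⁺¹⁾ = b/a` yields `a^{i+1} b ≤ E`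
(`mixedMult_eq_of_lojExp_eq`).

The foundation is a multigraded Hilbert theorem, by Noetherian induction on graded submodules of a
Rees algebra. It also shows that the normalized top-degree coefficients are natural numbers
(`TopNat`). Monotonicity is this nonnegativity applied to the lengths of `L' 𝓘^k / L 𝓘^k` for `L ≤
L'`. -/

noncomputable section

namespace MixedLoj

/-! ### Degree filtration, translations and growth of polynomials -/

section Polynomials

open MvPolynomial

variable {ι : Type*}

/-- The space of polynomials all of whose monomials have total degree `< d`. -/
def degLT (ι : Type*) (d : ℕ) : Submodule ℚ (MvPolynomial ι ℚ) where
  carrier := {P | ∀ β : ι →₀ ℕ, d ≤ β.degree → P.coeff β = 0}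
  add_mem' := fun hP hQ β h => by rw [coeff_add, hP β h, hQ β h, add_zero]
  zero_mem' := fun β _ => coeff_zero β
  smul_mem' := fun c P hP β h => by rw [coeff_smul, hP β h, smul_zero]

lemma degLT_mono {d e : ℕ} (h : d ≤ e) : degLT ι d ≤ degLT ι e :=
  fun _ hP β hβ => hP β (h.trans hβ)

lemma mem_degLT_of_totalDegree_lt {d : ℕ} {P : MvPolynomial ι ℚ} (h : P.totalDegree < d) :
    P ∈ degLT ι d := fun β hβ => by
  by_contra hc
  have := le_totalDegree (mem_support_iff.2 hc)
  rw [Finsupp.sum, ← Finsupp.degree_apply] at this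
  omega

lemma X_mul_mem_degLT {d : ℕ} {P : MvPolynomial ι ℚ} (hP : P ∈ degLT ι d) (i : ι) :
    X i * P ∈ degLT ι (d + 1) := by
  classical
  intro β hβ
  rw [coeff_X_mul']
  split_ifs with h
  · apply hP
    have h1 : β - Finsupp.single i 1 + Finsupp.single i 1 = β := by
      apply tsub_add_cancel_of_le
      rw [Finsupp.single_le_iff]
      exact Nat.one_le_iff_ne_zero.2 (Finsupp.mem_support_iff.1 h)
    rw [← h1, map_add, Finsupp.degree_single] at hβ
    omega
  · rfl

lemma C_mul_mem_degLT {d : ℕ} {P : MvPolynomial ι ℚ} (hP : P ∈ degLT ι d) (c : ℚ) :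
    C c * P ∈ degLT ι d := by
  rw [← smul_eq_C_mul]
  exact (degLT ι d).smul_mem c hP

lemma monomial_mem_degLT {d : ℕ} (s : ι →₀ ℕ) (c : ℚ) (h : s.degree < d) :
    monomial s c ∈ degLT ι d := by
  classical
  intro β hβ
  rw [coeff_monomial, if_neg]
  rintro rfl
  omega

/-- The translation `P(x) ↦ P(x + v)`. -/
def translate (v : ι → ℚ) : MvPolynomial ι ℚ →ₐ[ℚ] MvPolynomial ι ℚ :=
  aeval fun i => X i + C (v i)

lemma eval_translate (v x : ι → ℚ) (P : MvPolynomial ι ℚ) :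
    eval x (translate v P) = eval (fun i => x i + v i) P := by
  induction P using MvPolynomial.induction_on with
  | C a => simp [translate]
  | add p q hp hq => simp [hp, hq]
  | mul_X p i hp => rw [map_mul, map_mul, hp]; simp [translate]

lemma exists_eq_add_single {s : ι →₀ ℕ} {d : ℕ} (h : s.degree = d + 1) :
    ∃ (i : ι) (t : ι →₀ ℕ), s = Finsupp.single i 1 + t ∧ t.degree = d := by
  have hs : s ≠ 0 := by rintro rfl; simp at h
  obtain ⟨i, hi⟩ := Finsupp.support_nonempty_iff.2 hs
  have h1 : Finsupp.single i 1 + (s - Finsupp.single i 1) = s := by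
    apply add_tsub_cancel_of_le
    rw [Finsupp.single_le_iff]
    exact Nat.one_le_iff_ne_zero.2 (Finsupp.mem_support_iff.1 hi)
  refine ⟨i, s - Finsupp.single i 1, h1.symm, ?_⟩
  rw [← h1, map_add, Finsupp.degree_single] at h
  omega

lemma monomial_single_add_eq (i : ι) (t : ι →₀ ℕ) :
    (monomial (Finsupp.single i 1 + t) 1 : MvPolynomial ι ℚ) = X i * monomial t 1 := by
  rw [X, monomial_mul, one_mul]

lemma translate_monomial_sub_mem (v : ι → ℚ) (d : ℕ) : ∀ s : ι →₀ ℕ, s.degree = d →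
    translate v (monomial s 1) - monomial s 1 ∈ degLT ι d := by
  induction d with
  | zero =>
    intro s hs
    have : s = 0 := (Finsupp.degree_eq_zero_iff s).1 hs
    subst this
    have : translate v (monomial 0 1) - monomial 0 1 = 0 := by
      rw [show (monomial (0 : ι →₀ ℕ) (1 : ℚ)) = 1 from rfl, map_one, sub_self]
    rw [this]
    exact zero_mem _
  | succ d ih =>
    intro s hs
    obtain ⟨i, t, rfl, ht⟩ := exists_eq_add_single hs
    rw [monomial_single_add_eq, map_mul]
    have h1 := ih t ht
    have h2 : translate v (X i) = X i + C (v i) := by simp [translate]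
    have h3 : translate v (X i) * translate v (monomial t 1) - X i * monomial t 1
      = (X i * (translate v (monomial t 1) - monomial t 1)
        + C (v i) * (translate v (monomial t 1) - monomial t 1)) + C (v i) * monomial t 1 := by
      rw [h2]; ring
    rw [h3]
    refine add_mem (add_mem (X_mul_mem_degLT h1 i) (C_mul_mem_degLT (degLT_mono (by omega) h1) _))
      (C_mul_mem_degLT (monomial_mem_degLT _ _ (by omega)) _)

/-- First-order Taylor expansion, by induction through the product rule. For `d = 0` both the
difference and the derivative vanish, so the truncated `d - 1` is harmless. -/
lemma translate_monomial_sub_pderiv_mem [DecidableEq ι] (j : ι) (d : ℕ) :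
    ∀ s : ι →₀ ℕ, s.degree = d →
    translate (Pi.single j 1) (monomial s 1) - monomial s 1 - pderiv j (monomial s 1)
      ∈ degLT ι (d - 1) := by
  induction d with
  | zero =>
    intro s hs
    have : s = 0 := (Finsupp.degree_eq_zero_iff s).1 hs
    subst this
    rw [show (monomial (0 : ι →₀ ℕ) (1 : ℚ)) = 1 from rfl, map_one, sub_self, zero_sub,
      Derivation.map_one_eq_zero, neg_zero]
    exact zero_mem _
  | succ d ih =>
    intro s hs
    obtain ⟨i, t, rfl, ht⟩ := exists_eq_add_single hs
    rw [monomial_single_add_eq, map_mul, pderiv_mul]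
    have h1 := ih t ht
    have h0 := translate_monomial_sub_mem (Pi.single j 1) d t ht
    set τ := translate (Pi.single j (1 : ℚ))
    have h2 : τ (X i) = X i + C ((Pi.single j (1 : ℚ) : ι → ℚ) i) := by simp [τ, translate]
    have h4 : pderiv j (X i : MvPolynomial ι ℚ) = C ((Pi.single j (1 : ℚ) : ι → ℚ) i) := by
      rw [pderiv_X]
      by_cases h : i = j
      · subst h; simp
      · simp [h]
    have h3 : τ (X i) * τ (monomial t 1) - X i * monomial t 1
        - (pderiv j (X i) * monomial t 1 + X i * pderiv j (monomial t 1))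
      = X i * (τ (monomial t 1) - monomial t 1 - pderiv j (monomial t 1))
        + C ((Pi.single j (1 : ℚ) : ι → ℚ) i) * (τ (monomial t 1) - monomial t 1) := by
      rw [h2, h4]; ring
    rw [h3, Nat.add_sub_cancel]
    refine add_mem ?_ (C_mul_mem_degLT h0 _)
    rcases d with _ | d
    · have : t = 0 := (Finsupp.degree_eq_zero_iff t).1 ht
      subst this
      rw [show (monomial (0 : ι →₀ ℕ) (1 : ℚ)) = 1 from rfl, map_one, sub_self, zero_sub,
        Derivation.map_one_eq_zero, neg_zero, mul_zero]
      exact zero_mem _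
    · exact X_mul_mem_degLT h1 i

lemma linearMap_mem_degLT {d e : ℕ} (A : MvPolynomial ι ℚ →ₗ[ℚ] MvPolynomial ι ℚ)
    (hA : ∀ s : ι →₀ ℕ, s.degree < d → A (monomial s 1) ∈ degLT ι e)
    {P : MvPolynomial ι ℚ} (hP : P ∈ degLT ι d) : A P ∈ degLT ι e := by
  rw [P.as_sum, map_sum]
  refine sum_mem fun s hs => ?_
  have h1 : (monomial s (coeff s P) : MvPolynomial ι ℚ) = coeff s P • monomial s 1 := by
    rw [smul_monomial, smul_eq_mul, mul_one]
  rw [h1, map_smul]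
  refine (degLT ι e).smul_mem _ (hA s ?_)
  by_contra h
  exact mem_support_iff.1 hs (hP s (not_lt.1 h))

lemma translate_sub_mem (v : ι → ℚ) {d : ℕ} {P : MvPolynomial ι ℚ} (hP : P ∈ degLT ι (d + 1)) :
    translate v P - P ∈ degLT ι d := by
  refine linearMap_mem_degLT (d := d + 1) ((translate v).toLinearMap - LinearMap.id) ?_ hP
  intro s hs
  exact degLT_mono (by omega) (translate_monomial_sub_mem v _ s rfl)

lemma translate_mem (v : ι → ℚ) {d : ℕ} {P : MvPolynomial ι ℚ} (hP : P ∈ degLT ι d) :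
    translate v P ∈ degLT ι d := by
  rcases d with _ | d
  · have : P = 0 := by ext β; simpa using hP β (Nat.zero_le _)
    rw [this, map_zero]
    exact zero_mem _
  · have := add_mem (degLT_mono (Nat.le_succ d) (translate_sub_mem v hP)) hP
    rwa [sub_add_cancel] at this

lemma coeff_translate_of_mem (v : ι → ℚ) {β : ι →₀ ℕ} {P : MvPolynomial ι ℚ}
    (hP : P ∈ degLT ι (β.degree + 1)) : coeff β (translate v P) = coeff β P := by
  have := translate_sub_mem v hP β le_rfl
  rwa [coeff_sub, sub_eq_zero] at this

lemma coeff_translate_single_sub [DecidableEq ι] (j : ι) {β : ι →₀ ℕ} {P : MvPolynomial ι ℚ}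
    (hP : P ∈ degLT ι (β.degree + 2)) :
    coeff β (translate (Pi.single j 1) P - P)
      = coeff (β + Finsupp.single j 1) P * (β j + 1) := by
  have h := linearMap_mem_degLT (d := β.degree + 2) (e := β.degree)
    ((translate (Pi.single j 1)).toLinearMap - LinearMap.id - (pderiv j).toLinearMap)
    (fun s hs => degLT_mono (by omega) (translate_monomial_sub_pderiv_mem j _ s rfl)) hP β le_rfl
  have h' : coeff β (translate (Pi.single j 1) P - P - pderiv j P) = 0 := h
  rw [coeff_sub, sub_eq_zero] at h'
  rw [h', coeff_pderiv]

/-- Evaluation of a polynomial at a point with natural coordinates. -/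
abbrev evalNat (P : MvPolynomial ι ℚ) (k : ι → ℕ) : ℚ := eval (fun i => (k i : ℚ)) P

/-- A product of infinite subsets of `ℚ` is Zariski dense. -/
lemma eq_of_evalNat_eq {P Q : MvPolynomial ι ℚ} (K : ℕ)
    (h : ∀ k : ι → ℕ, (∀ i, K ≤ k i) → evalNat P k = evalNat Q k) : P = Q := by
  refine funext_set (fun _ => (fun m : ℕ => (m : ℚ)) '' Set.Ici K) (fun _ => ?_) fun x hx => ?_
  · exact (Set.Ici_infinite K).image Nat.cast_injective.injOn
  · choose k hk hkx using fun i => hx i (Set.mem_univ i)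
    have : x = fun i => (k i : ℚ) := funext fun i => (hkx i).symm
    rw [this]
    exact h k hk

lemma evalNat_translate_single [DecidableEq ι] (j : ι) (P : MvPolynomial ι ℚ) (k : ι → ℕ) :
    evalNat (translate (Pi.single j 1) P) k = evalNat P (k + Pi.single j 1) := by
  rw [evalNat, eval_translate, evalNat]
  congr 2
  funext i
  by_cases h : i = j
  · subst h; simp
  · simp [Pi.single_eq_of_ne h]

section Growth

/-- The restriction of `P` to the line through `0` and `u`. -/
def alongRay (u : ι → ℚ) : MvPolynomial ι ℚ →ₐ[ℚ] Polynomial ℚ :=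
  aeval fun i => Polynomial.C (u i) * Polynomial.X

lemma eval_alongRay (u : ι → ℚ) (t : ℚ) (P : MvPolynomial ι ℚ) :
    (alongRay u P).eval t = eval (fun i => u i * t) P := by
  induction P using MvPolynomial.induction_on with
  | C a => simp [alongRay]
  | add p q hp hq => simp [hp, hq]
  | mul_X p i hp => rw [map_mul, Polynomial.eval_mul, hp]; simp [alongRay]

lemma alongRay_monomial (u : ι → ℚ) (s : ι →₀ ℕ) (c : ℚ) :
    alongRay u (monomial s c) = Polynomial.C (eval u (monomial s c)) * Polynomial.X ^ s.degree := by
  rw [alongRay, aeval_monomial, eval_monomial]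
  simp only [mul_pow, Finsupp.prod, Finset.prod_mul_distrib, Finset.prod_pow_eq_pow_sum,
    Polynomial.algebraMap_eq, map_mul, map_prod, map_pow, Finsupp.degree_apply]
  ring

lemma coeff_alongRay (u : ι → ℚ) (e : ℕ) (P : MvPolynomial ι ℚ) :
    (alongRay u P).coeff e = eval u (homogeneousComponent e P) := by
  classical
  induction P using MvPolynomial.induction_on' with
  | monomial s c =>
    have h : homogeneousComponent e (monomial s c) = if s.degree = e then monomial s c else 0 := by
      ext β
      rw [coeff_homogeneousComponent]
      split_ifs with h1 h2 h2
      · rfl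
      · rw [coeff_monomial, if_neg, coeff_zero]
        rintro rfl; exact h2 h1
      · rw [coeff_monomial, if_neg]
        rintro rfl; exact h1 h2
      · rfl
    rw [alongRay_monomial, Polynomial.coeff_C_mul, Polynomial.coeff_X_pow, h]
    by_cases h1 : s.degree = e
    · simp [h1]
    · rw [if_neg (Ne.symm h1), if_neg h1]; simp
  | add p q hp hq => rw [map_add, map_add, map_add, Polynomial.coeff_add, hp, hq]

lemma natDegree_alongRay_le (u : ι → ℚ) {e : ℕ} {P : MvPolynomial ι ℚ} (hP : P ∈ degLT ι (e + 1)) :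
    (alongRay u P).natDegree ≤ e := by
  rw [Polynomial.natDegree_le_iff_coeff_eq_zero]
  intro N hN
  rw [coeff_alongRay]
  have : homogeneousComponent N P = 0 := by
    ext β
    rw [coeff_homogeneousComponent, coeff_zero]
    split_ifs with h
    · exact hP β (by omega)
    · rfl
  rw [this, map_zero]

/-- A negative coefficient in degree `e` would be the leading one, making `p` constant and negative
or tend to `-∞`. -/
lemma coeff_nonneg_of_eventually_nonneg {p : Polynomial ℚ} {e : ℕ} (hp : p.natDegree ≤ e) (K : ℕ)
    (h : ∀ t : ℕ, K ≤ t → 0 ≤ p.eval (t : ℚ)) : 0 ≤ p.coeff e := by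
  by_contra hc
  push Not at hc
  have he : p.natDegree = e :=
    le_antisymm hp (Polynomial.le_natDegree_of_ne_zero hc.ne)
  have hlc : p.leadingCoeff = p.coeff e := by rw [Polynomial.leadingCoeff, he]
  rcases Nat.eq_zero_or_pos e with h0 | h0
  · subst h0
    rw [Polynomial.eq_C_of_natDegree_eq_zero he] at h
    have := h K le_rfl
    rw [Polynomial.eval_C] at this
    linarith
  · have ht := (Polynomial.tendsto_atBot_of_leadingCoeff_nonpos p
      (Polynomial.natDegree_pos_iff_degree_pos.1 (he ▸ h0)) (hlc ▸ hc.le)).comp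
      (tendsto_natCast_atTop_atTop (R := ℚ))
    obtain ⟨t, h1, h2⟩ := ((ht.eventually (Filter.eventually_lt_atBot 0)).and
      (Filter.eventually_ge_atTop K)).exists
    exact absurd (h t h2) (not_le.2 h1)

/-- A polynomial squeezed between `0` and `E` at large lattice points has degree at most that
of `E`. -/
lemma mem_degLT_of_le {D E : MvPolynomial ι ℚ} {d : ℕ} (hE : E ∈ degLT ι d) (K : ℕ)
    (h0 : ∀ k : ι → ℕ, (∀ i, K ≤ k i) → 0 ≤ evalNat D k)
    (h1 : ∀ k : ι → ℕ, (∀ i, K ≤ k i) → evalNat D k ≤ evalNat E k) : D ∈ degLT ι d := by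
  -- The degree bound drops one step at a time. On the ray through `u` the top coefficient of `D` is
  -- its homogeneous component of degree `d + t` at `u`; it lies between `0` and the same
  -- coefficient of `E`, which is `0`. So the component vanishes at all positive lattice points.
  have key : ∀ t : ℕ, D ∈ degLT ι (d + t) → D ∈ degLT ι d := by
    intro t
    induction t with
    | zero => exact id
    | succ t ih =>
      intro ht
      apply ih
      have hz : homogeneousComponent (d + t) D = 0 := by
        refine eq_of_evalNat_eq 1 fun u hu => ?_
        have hcast : ∀ (P : MvPolynomial ι ℚ) (m : ℕ),
            (alongRay (fun i => (u i : ℚ)) P).eval (m : ℚ) = evalNat P (fun i => u i * m) := by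
          intro P m
          rw [eval_alongRay, evalNat]
          simp
        have hge : ∀ m : ℕ, K ≤ m → ∀ i, K ≤ u i * m := fun m hm i =>
          hm.trans (Nat.le_mul_of_pos_left m (hu i))
        have hEc : (alongRay (fun i => (u i : ℚ)) E).coeff (d + t) = 0 := by
          rw [coeff_alongRay]
          have : homogeneousComponent (d + t) E = 0 := by
            ext β
            rw [coeff_homogeneousComponent, coeff_zero]
            split_ifs with h
            · exact hE β (by omega)
            · rfl
          rw [this, map_zero]
        have a1 := coeff_nonneg_of_eventually_nonneg (natDegree_alongRay_le _ ht) K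
          (fun m hm => by rw [hcast]; exact h0 _ (hge m hm))
        have a2 := coeff_nonneg_of_eventually_nonneg
          (natDegree_alongRay_le (fun i => (u i : ℚ)) (e := d + t)
            (sub_mem (degLT_mono (by omega) hE) ht)) K
          (fun m hm => by
            rw [hcast]
            have := h1 _ (hge m hm)
            rw [evalNat, map_sub, sub_nonneg]
            exact this)
        rw [map_sub, Polynomial.coeff_sub, hEc] at a2
        rw [evalNat, evalNat, map_zero, ← coeff_alongRay]
        exact le_antisymm (by linarith) a1
      intro β hβ
      rcases hβ.eq_or_lt with h | h
      · have := congrArg (coeff β) hz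
        rwa [coeff_homogeneousComponent, if_pos h.symm, coeff_zero] at this
      · exact ht β (by omega)
  exact key (D.totalDegree + 1) (mem_degLT_of_totalDegree_lt (by omega))

end Growth

end Polynomials

/-! ### Eventually polynomial functions and integrality of top-degree coefficients -/

section Numerical

open MvPolynomial

variable {ι : Type*}

/-- The top-degree coefficients of `P`, multiplied by the factorials of the exponents, are
natural numbers. -/
def TopNat [Fintype ι] (P : MvPolynomial ι ℚ) : Prop :=
  ∀ β : ι →₀ ℕ, P ∈ degLT ι (β.degree + 1) →
    ∃ c : ℕ, ((∏ i, (β i).factorial : ℕ) : ℚ) * P.coeff β = c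

/-- `P` computes `H` at all lattice points with large coordinates. -/
def EventuallyEval (H : (ι → ℕ) → ℚ) (P : MvPolynomial ι ℚ) : Prop :=
  ∃ K : ℕ, ∀ k : ι → ℕ, (∀ i, K ≤ k i) → evalNat P k = H k

lemma EventuallyEval.add {H₁ H₂ : (ι → ℕ) → ℚ} {P₁ P₂ : MvPolynomial ι ℚ}
    (h₁ : EventuallyEval H₁ P₁) (h₂ : EventuallyEval H₂ P₂) :
    EventuallyEval (fun k => H₁ k + H₂ k) (P₁ + P₂) := by
  obtain ⟨K₁, h₁⟩ := h₁
  obtain ⟨K₂, h₂⟩ := h₂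
  refine ⟨max K₁ K₂, fun k hk => ?_⟩
  rw [evalNat, map_add]
  exact congrArg₂ _ (h₁ k fun i => (le_max_left _ _).trans (hk i))
    (h₂ k fun i => (le_max_right _ _).trans (hk i))

lemma EventuallyEval.sub {H₁ H₂ : (ι → ℕ) → ℚ} {P₁ P₂ : MvPolynomial ι ℚ}
    (h₁ : EventuallyEval H₁ P₁) (h₂ : EventuallyEval H₂ P₂) :
    EventuallyEval (fun k => H₁ k - H₂ k) (P₁ - P₂) := by
  obtain ⟨K₁, h₁⟩ := h₁
  obtain ⟨K₂, h₂⟩ := h₂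
  refine ⟨max K₁ K₂, fun k hk => ?_⟩
  rw [evalNat, map_sub]
  exact congrArg₂ _ (h₁ k fun i => (le_max_left _ _).trans (hk i))
    (h₂ k fun i => (le_max_right _ _).trans (hk i))

lemma EventuallyEval.unique {H : (ι → ℕ) → ℚ} {P₁ P₂ : MvPolynomial ι ℚ}
    (h₁ : EventuallyEval H P₁) (h₂ : EventuallyEval H P₂) : P₁ = P₂ := by
  obtain ⟨K₁, h₁⟩ := h₁
  obtain ⟨K₂, h₂⟩ := h₂
  refine eq_of_evalNat_eq (max K₁ K₂) fun k hk => ?_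
  rw [h₁ k fun i => (le_max_left _ _).trans (hk i), h₂ k fun i => (le_max_right _ _).trans (hk i)]

lemma EventuallyEval.shift [DecidableEq ι] {H : (ι → ℕ) → ℚ} {P : MvPolynomial ι ℚ}
    (h : EventuallyEval H P) (j : ι) :
    EventuallyEval (fun k => H (k + Pi.single j 1)) (translate (Pi.single j 1) P) := by
  obtain ⟨K, h⟩ := h
  refine ⟨K, fun k hk => ?_⟩
  rw [evalNat_translate_single]
  exact h _ fun i => (hk i).trans (Nat.le_add_right _ _)

/-- If `k ↦ H (k + e_j)` is eventually polynomial, so is `H`. -/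
lemma EventuallyEval.unshift [DecidableEq ι] {H : (ι → ℕ) → ℚ} {P : MvPolynomial ι ℚ} {j : ι}
    (h : EventuallyEval (fun k => H (k + Pi.single j 1)) P) :
    EventuallyEval H (translate (-Pi.single j 1) P) := by
  obtain ⟨K, h⟩ := h
  refine ⟨K + 1, fun k hk => ?_⟩
  have h1 : k = (k - Pi.single j 1) + Pi.single j 1 := by
    funext i
    have := hk i
    by_cases h : i = j
    · subst h
      simp only [Pi.add_apply, Pi.sub_apply, Pi.single_eq_same]
      omega
    · simp [Pi.single_eq_of_ne h]
  have h2 := h (k - Pi.single j 1) (fun i => by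
    have := hk i
    by_cases h : i = j
    · subst h
      simp only [Pi.sub_apply, Pi.single_eq_same]
      omega
    · simp only [Pi.sub_apply, Pi.single_eq_of_ne h]
      omega)
  simp only [← h1] at h2
  rw [← h2, evalNat, eval_translate, evalNat]
  congr 2
  funext i
  by_cases h : i = j
  · subst h
    have := hk i
    rw [Pi.neg_apply, Pi.single_eq_same, Pi.sub_apply, Pi.single_eq_same,
      Nat.cast_sub (by omega)]
    push_cast; ring
  · simp [Pi.single_eq_of_ne h]

lemma TopNat.translate [Fintype ι] {P : MvPolynomial ι ℚ} (hP : TopNat P) (v : ι → ℚ) :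
    TopNat (translate v P) := by
  intro β hβ
  have hP' : P ∈ degLT ι (β.degree + 1) := by
    have h := translate_mem (-v) hβ
    have : MixedLoj.translate (-v) (MixedLoj.translate v P) = P := by
      refine MvPolynomial.funext fun x => ?_
      rw [eval_translate, eval_translate]
      simp
    rwa [this] at h
  rw [coeff_translate_of_mem v hP']
  exact hP β hP'

/-- Nonnegativity forbids cancellation between top-degree parts, so a degree bound on `P + Q` holds
for `P` and `Q` separately. -/
lemma TopNat.add [Fintype ι] {P Q : MvPolynomial ι ℚ} (hP : TopNat P) (hQ : TopNat Q) :
    TopNat (P + Q) := by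
  intro β hβ
  have key : ∀ t : ℕ, P ∈ degLT ι (β.degree + 1 + t) → Q ∈ degLT ι (β.degree + 1 + t) →
      P ∈ degLT ι (β.degree + 1) ∧ Q ∈ degLT ι (β.degree + 1) := by
    intro t
    induction t with
    | zero => exact fun h1 h2 => ⟨h1, h2⟩
    | succ t ih =>
      intro h1 h2
      have main : ∀ γ : ι →₀ ℕ, β.degree + 1 + t ≤ γ.degree → P.coeff γ = 0 ∧ Q.coeff γ = 0 := by
        intro γ hγ
        rcases hγ.eq_or_lt with h | h
        · obtain ⟨c, hc⟩ := hP γ (by rwa [← h])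
          obtain ⟨d, hd⟩ := hQ γ (by rwa [← h])
          have h0 : coeff γ P + coeff γ Q = 0 := by
            rw [← coeff_add]
            exact hβ γ (by omega)
          have hpos : (0 : ℚ) < ((∏ i, (γ i).factorial : ℕ) : ℚ) :=
            Nat.cast_pos.2 (Finset.prod_pos fun i _ => Nat.factorial_pos _)
          have h3 : (c : ℚ) + d = 0 := by rw [← hc, ← hd, ← mul_add, h0, mul_zero]
          have hc0 : (c : ℚ) = 0 := by
            have : (0 : ℚ) ≤ c := Nat.cast_nonneg c
            have : (0 : ℚ) ≤ d := Nat.cast_nonneg d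
            linarith
          have hd0 : (d : ℚ) = 0 := by linarith
          rw [hc0] at hc
          rw [hd0] at hd
          exact ⟨(mul_eq_zero.1 hc).resolve_left hpos.ne',
            (mul_eq_zero.1 hd).resolve_left hpos.ne'⟩
        · exact ⟨h1 γ (by omega), h2 γ (by omega)⟩
      exact ih (fun γ hγ => (main γ hγ).1) fun γ hγ => (main γ hγ).2
  obtain ⟨h1, h2⟩ := key (P.totalDegree + Q.totalDegree + 1)
    (mem_degLT_of_totalDegree_lt (by omega)) (mem_degLT_of_totalDegree_lt (by omega))
  obtain ⟨c, hc⟩ := hP β h1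
  obtain ⟨d, hd⟩ := hQ β h2
  exact ⟨c + d, by rw [coeff_add, mul_add, hc, hd, Nat.cast_add]⟩

section Antidifference

/-- A univariate antidifference of `X ^ a`. -/
def powSum (a : ℕ) : Polynomial ℚ :=
  Polynomial.C ((a + 1 : ℚ)⁻¹) * Polynomial.bernoulli (a + 1)

/-- The identity `B_{a+1}(x+1) - B_{a+1}(x) = (a+1) x^a` for Bernoulli polynomials. -/
lemma eval_powSum_add_one (a : ℕ) (x : ℚ) :
    (powSum a).eval (x + 1) = (powSum a).eval x + x ^ a := by
  have : (a + 1 : ℚ) ≠ 0 := by positivity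
  rw [powSum, Polynomial.eval_mul, Polynomial.eval_mul, add_comm x 1,
    Polynomial.bernoulli_eval_one_add, Polynomial.eval_C]
  push_cast
  field_simp [Polynomial.eval_C]
  simp
  field_simp

lemma exists_antidifference [DecidableEq ι] (j : ι) (Q : MvPolynomial ι ℚ) :
    ∃ S : MvPolynomial ι ℚ, ∀ k : ι → ℕ,
      evalNat S (k + Pi.single j 1) = evalNat S k + evalNat Q k := by
  induction Q using MvPolynomial.induction_on' with
  | monomial s c =>
    refine ⟨monomial (s.erase j) c * Polynomial.aeval (X j) (powSum (s j)), fun k => ?_⟩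
    have h1 : ∀ k : ι → ℕ, evalNat (Polynomial.aeval (X j : MvPolynomial ι ℚ) (powSum (s j))) k
        = (powSum (s j)).eval (k j : ℚ) := by
      intro k
      have := Polynomial.aeval_algHom_apply (MvPolynomial.aeval (fun i => (k i : ℚ)) :
        MvPolynomial ι ℚ →ₐ[ℚ] ℚ) (X j) (powSum (s j))
      rw [MvPolynomial.aeval_X] at this
      rw [evalNat, ← MvPolynomial.coe_aeval_eq_eval]
      simp only [RingHom.coe_coe]
      rw [← this, Polynomial.coe_aeval_eq_eval]
    have h2 : evalNat (monomial (s.erase j) c) (k + Pi.single j 1)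
        = evalNat (monomial (s.erase j) c) k := by
      rw [evalNat, evalNat, eval_monomial, eval_monomial]
      congr 1
      refine Finsupp.prod_congr fun i hi => ?_
      have : i ≠ j := by
        rintro rfl
        simp at hi
      simp [Pi.single_eq_of_ne this]
    have h3 : evalNat (monomial s c) k = evalNat (monomial (s.erase j) c) k * (k j : ℚ) ^ s j := by
      rw [evalNat, evalNat, eval_monomial, eval_monomial]
      conv_lhs => rw [← Finsupp.erase_add_single j s]
      rw [Finsupp.prod_add_index' (by simp) (by intros; rw [pow_add]), Finsupp.prod_single_index
        (by simp), mul_assoc]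
    rw [h3]
    simp only [evalNat, map_mul] at h1 h2 ⊢
    rw [h1, h1, h2]
    simp only [Pi.add_apply, Pi.single_eq_same]
    push_cast
    rw [eval_powSum_add_one]
    ring
  | add p q hp hq =>
    obtain ⟨S₁, h₁⟩ := hp
    obtain ⟨S₂, h₂⟩ := hq
    refine ⟨S₁ + S₂, fun k => ?_⟩
    simp only [evalNat, map_add] at h₁ h₂ ⊢
    rw [h₁, h₂]
    ring

end Antidifference

/-- The point with the coordinates in `T` replaced by `K`. -/
def freeze [DecidableEq ι] (K : ℕ) (T : Finset ι) (k : ι → ℕ) : ι → ℕ :=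
  fun i => if i ∈ T then K else k i

lemma exists_evalNat_freeze [DecidableEq ι] (K : ℕ) (T : Finset ι) (P : MvPolynomial ι ℚ) :
    ∃ Q : MvPolynomial ι ℚ, ∀ k, evalNat Q k = evalNat P (freeze K T k) := by
  refine ⟨aeval (fun i => if i ∈ T then C (K : ℚ) else X i) P, fun k => ?_⟩
  induction P using MvPolynomial.induction_on with
  | C a => simp [evalNat]
  | add p q hp hq => simp only [evalNat, map_add] at hp hq ⊢; rw [hp, hq]
  | mul_X p i hp =>
    simp only [evalNat, map_mul] at hp ⊢
    rw [hp, aeval_X, eval_X, freeze]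
    split_ifs <;> simp

/-- A function whose partial differences are eventually polynomial is eventually polynomial. -/
lemma exists_eventuallyEval_of_difference [Fintype ι] [DecidableEq ι] (H : (ι → ℕ) → ℚ)
    (h : ∀ j, ∃ Q, EventuallyEval (fun k => H (k + Pi.single j 1) - H k) Q) :
    ∃ P, EventuallyEval H P := by
  choose Q K₀ hQ using h
  obtain ⟨K, hK⟩ : ∃ K, ∀ j, K₀ j ≤ K :=
    ⟨Finset.univ.sup K₀, fun j => Finset.le_sup (Finset.mem_univ j)⟩
  -- Coordinates are frozen at `K` one after another, each at the cost of a polynomial correction.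
  -- Once all are frozen, only a constant remains.
  have key : ∀ T : Finset ι, ∃ P : MvPolynomial ι ℚ, ∀ k : ι → ℕ, (∀ i, K ≤ k i) →
      H k = H (freeze K T k) + evalNat P k := by
    intro T
    induction T using Finset.induction_on with
    | empty => exact ⟨0, fun k _ => by simp [show freeze K ∅ k = k from rfl, evalNat]⟩
    | insert j T hj ih =>
      obtain ⟨P, hP⟩ := ih
      obtain ⟨S, hS⟩ := exists_antidifference j (Q j)
      obtain ⟨S₁, hS₁⟩ := exists_evalNat_freeze K T S
      obtain ⟨S₂, hS₂⟩ := exists_evalNat_freeze K (insert j T) S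
      refine ⟨P + (S₁ - S₂), fun k hk => ?_⟩
      -- As `S` is an antidifference of `Q j`, the function `H - S` is constant along direction `j`
      -- beyond `K`.
      have step : ∀ (t : ℕ) (l : ι → ℕ), (∀ i, K ≤ l i) →
          H (l + Pi.single j t) - evalNat S (l + Pi.single j t) = H l - evalNat S l := by
        intro t l hl
        induction t with
        | zero => simp
        | succ t ih =>
          have e : l + Pi.single j (t + 1) = (l + Pi.single j t) + Pi.single j 1 := by
            rw [add_assoc, ← Pi.single_add]
          have hge : ∀ i, K₀ j ≤ (l + Pi.single j t : ι → ℕ) i := fun i =>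
            (hK j).trans ((hl i).trans (Nat.le_add_right _ _))
          have := hQ j _ hge
          rw [e, hS, ← ih]
          simp only at this
          linarith
      have e : freeze K T k = freeze K (insert j T) k + Pi.single j (k j - K) := by
        funext i
        by_cases hi : i = j
        · subst hi
          have := hk i
          simp only [freeze, hj, if_false, Finset.mem_insert_self, if_true, Pi.add_apply,
            Pi.single_eq_same]
          omega
        · simp [freeze, Finset.mem_insert, hi]
      have h1 := step (k j - K) (freeze K (insert j T) k) (fun i => by
        unfold freeze
        split_ifs
        · exact le_rfl
        · exact hk i)
      rw [← e, ← hS₁, ← hS₂] at h1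
      rw [hP k hk, evalNat, evalNat, map_add, map_sub]
      simp only [evalNat] at h1
      linarith
  obtain ⟨P, hP⟩ := key Finset.univ
  refine ⟨C (H fun _ => K) + P, K, fun k hk => ?_⟩
  rw [hP k hk, evalNat, map_add, eval_C]
  congr 2
  funext i
  simp [freeze]

/-- For `β = γ + e_j`, the `γ`-coefficient of the difference of `P` in direction `j` is `β_j` times
the `β`-coefficient of `P`, so the factorial-weighted coefficients agree. For `β = 0` the polynomial
is constant, hence a value of `H`. -/
lemma topNat_of_difference [Fintype ι] [DecidableEq ι] {H : (ι → ℕ) → ℚ}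
    (hH : ∀ k, ∃ c : ℕ, H k = c) {P : MvPolynomial ι ℚ} (hP : EventuallyEval H P)
    (h : ∀ j, ∃ Q, EventuallyEval (fun k => H (k + Pi.single j 1) - H k) Q ∧ TopNat Q) :
    TopNat P := by
  intro β hβ
  by_cases hβ0 : β = 0
  · subst hβ0
    obtain ⟨K, hK⟩ := hP
    have hPC : P = C (coeff 0 P) := by
      ext γ
      rw [coeff_C]
      split_ifs with h0
      · rw [← h0]
      · refine hβ γ ?_
        have : γ.degree ≠ 0 := fun h1 => h0 ((Finsupp.degree_eq_zero_iff γ).1 h1).symm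
        simp only [map_zero]
        omega
    obtain ⟨c, hc⟩ := hH fun _ => K
    refine ⟨c, ?_⟩
    have := hK (fun _ => K) fun _ => le_rfl
    rw [hPC, evalNat, eval_C, hc] at this
    simp [this]
  · obtain ⟨j, hj⟩ := Finsupp.support_nonempty_iff.2 hβ0
    have hj' : β j ≠ 0 := Finsupp.mem_support_iff.1 hj
    set γ := β - Finsupp.single j 1 with hγ
    have hγβ : γ + Finsupp.single j 1 = β := by
      apply tsub_add_cancel_of_le
      rw [Finsupp.single_le_iff]
      exact Nat.one_le_iff_ne_zero.2 hj'
    have hdeg : β.degree = γ.degree + 1 := by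
      rw [← hγβ, map_add, Finsupp.degree_single]
    obtain ⟨Q, hQ, hQt⟩ := h j
    have hQP : Q = translate (Pi.single j 1) P - P := hQ.unique ((hP.shift j).sub hP)
    rw [hdeg] at hβ
    obtain ⟨c, hc⟩ := hQt γ (by rw [hQP]; exact translate_sub_mem _ hβ)
    refine ⟨c, ?_⟩
    rw [← hc, hQP, coeff_translate_single_sub j hβ, hγβ]
    have hfac : ∏ i, (β i).factorial = (∏ i, (γ i).factorial) * (γ j + 1) := by
      rw [← Finset.mul_prod_erase _ _ (Finset.mem_univ j),
        ← Finset.mul_prod_erase Finset.univ (fun i => (γ i).factorial) (Finset.mem_univ j)]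
      have h1 : β j = γ j + 1 := by rw [← hγβ]; simp
      have h2 : ∏ i ∈ Finset.univ.erase j, (β i).factorial
          = ∏ i ∈ Finset.univ.erase j, (γ i).factorial := by
        refine Finset.prod_congr rfl fun i hi => ?_
        rw [← hγβ]
        simp [Finsupp.single_eq_of_ne (Finset.ne_of_mem_erase hi)]
      rw [h1, h2, Nat.factorial_succ]
      ring
    rw [hfac]
    push_cast
    ring

end Numerical

/-! ### Lengths of quotients and colengths of powers -/

section Colength

variable {R : Type*} [CommRing R]

/-- The length of `R / B`. -/
abbrev quotLength (B : Ideal R) : ℕ∞ := Module.length R (R ⧸ B)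

/-- The length of `R / B` as a natural number, with the value `0` if it is infinite. -/
abbrev colength (B : Ideal R) : ℕ := (quotLength B).toNat

lemma quotLength_anti {A B : Ideal R} (h : A ≤ B) : quotLength B ≤ quotLength A :=
  Module.length_le_of_surjective (Submodule.factor h) (Submodule.factor_surjective h)

lemma quotLength_ne_top_of_le {A B : Ideal R} (h : A ≤ B) (hA : quotLength A ≠ ⊤) :
    quotLength B ≠ ⊤ := ne_top_of_le_ne_top hA (quotLength_anti h)

lemma colength_anti {A B : Ideal R} (h : A ≤ B) (hA : quotLength A ≠ ⊤) :
    colength B ≤ colength A := ENat.toNat_le_toNat (quotLength_anti h) hA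

lemma quotLength_eq_add {N A : Ideal R} (h : N ≤ A) :
    quotLength N = Module.length R (Submodule.map N.mkQ A) + quotLength A := by
  rw [quotLength, Module.length_eq_add_of_exact (Submodule.map N.mkQ A).subtype
    (Submodule.map N.mkQ A).mkQ (Submodule.subtype_injective _) (Submodule.mkQ_surjective _)
    (LinearMap.exact_subtype_mkQ _)]
  rw [(Submodule.quotientQuotientEquivQuotient N A h).length_eq]

/-- The ideal `(N : x)`. -/
abbrev colonElem (N : Ideal R) (x : R) : Ideal R := Submodule.comap (LinearMap.mulLeft R x) N

lemma mem_colonElem {N : Ideal R} {x y : R} : y ∈ colonElem N x ↔ x * y ∈ N := Iff.rfl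

/-- Multiplication by `x` induces `M / (M ∩ (N : x)) ≅ (N + xM) / N`. -/
lemma quotLength_add_quotLength (N M : Ideal R) (x : R) :
    quotLength N + quotLength M
      = quotLength (N ⊔ Ideal.span {x} * M) + quotLength (M ⊓ colonElem N x) := by
  set C := M ⊓ colonElem N x with hC
  rw [quotLength_eq_add (le_sup_left : N ≤ N ⊔ Ideal.span {x} * M),
    quotLength_eq_add (inf_le_left : C ≤ M)]
  let f : M →ₗ[R] R ⧸ N := N.mkQ ∘ₗ LinearMap.mulLeft R x ∘ₗ M.subtype
  let g : M →ₗ[R] R ⧸ C := Submodule.mkQ C ∘ₗ M.subtype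
  have hf : Submodule.map N.mkQ (N ⊔ Ideal.span {x} * M) = LinearMap.range f := by
    ext z
    constructor
    · rintro ⟨y, hy, rfl⟩
      obtain ⟨a, ha, b, hb, rfl⟩ := Submodule.mem_sup.1 hy
      obtain ⟨m, hm, rfl⟩ := Ideal.mem_span_singleton_mul.1 hb
      refine ⟨⟨m, hm⟩, ?_⟩
      simp only [f, LinearMap.comp_apply, map_add]
      rw [(Submodule.Quotient.mk_eq_zero N).2 ha |> (show N.mkQ a = 0 from ·), zero_add]
      rfl
    · rintro ⟨m, rfl⟩
      exact ⟨x * m, Submodule.mem_sup_right (Ideal.mem_span_singleton_mul.2 ⟨m, m.2, rfl⟩), rfl⟩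
  have hg : Submodule.map (Submodule.mkQ C) M = LinearMap.range g := by
    rw [LinearMap.range_comp, Submodule.range_subtype]
  have hker : LinearMap.ker f = LinearMap.ker g := by
    ext m
    simp only [LinearMap.mem_ker, f, g, LinearMap.comp_apply, Submodule.mkQ_apply,
      Submodule.Quotient.mk_eq_zero]
    exact ⟨fun h => ⟨m.2, h⟩, fun h => h.2⟩
  rw [hf, hg, ← f.quotKerEquivRange.length_eq, ← g.quotKerEquivRange.length_eq, hker]
  ac_rfl

/-- The preceding identity with `M = R` and `N = J + (xy)`: here `N + (x)` contains `J + (x)`, and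
`(N : x)` contains `J + (y)`. -/
lemma quotLength_sup_span_mul_le (J : Ideal R) (x y : R) :
    quotLength (J ⊔ Ideal.span {x * y})
      ≤ quotLength (J ⊔ Ideal.span {x}) + quotLength (J ⊔ Ideal.span {y}) := by
  have h := quotLength_add_quotLength (J ⊔ Ideal.span {x * y}) ⊤ x
  rw [Ideal.mul_top] at h
  refine le_self_add.trans (h.le.trans (add_le_add (quotLength_anti ?_) (quotLength_anti ?_)))
  · exact sup_le_sup_right le_sup_left _
  · refine le_inf le_top (sup_le (fun a ha => ?_) ?_)
    · rw [mem_colonElem]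
      exact Submodule.mem_sup_left (Ideal.mul_mem_left _ _ ha)
    · rw [Ideal.span_singleton_le_iff_mem, mem_colonElem]
      exact Submodule.mem_sup_right (Ideal.mem_span_singleton_self _)

lemma quotLength_sup_span_pow_le (J : Ideal R) (x : R) (k : ℕ) :
    quotLength (J ⊔ Ideal.span {x ^ k}) ≤ k * quotLength (J ⊔ Ideal.span {x}) := by
  induction k with
  | zero =>
    rw [pow_zero, Ideal.span_singleton_one, sup_top_eq, quotLength, Module.length_eq_zero]
    simp
  | succ k ih =>
    rw [pow_succ]
    refine (quotLength_sup_span_mul_le _ _ _).trans ?_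
    push_cast
    rw [add_mul, one_mul]
    exact add_le_add_left ih _

lemma quotLength_sup_span_image_pow_le [DecidableEq R] (k : ℕ) (s : Finset R) : ∀ J : Ideal R,
    quotLength (J ⊔ Ideal.span ((fun x => x ^ k) '' (s : Set R)))
      ≤ (k ^ s.card : ℕ) * quotLength (J ⊔ Ideal.span (s : Set R)) := by
  induction s using Finset.induction_on with
  | empty => intro J; simp
  | insert a s ha ih =>
    intro J
    rw [Finset.coe_insert, Set.image_insert_eq, Ideal.span_insert, Ideal.span_insert,
      Finset.card_insert_of_notMem ha, ← sup_assoc J (Ideal.span {a}),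
      sup_comm (Ideal.span {a ^ k}), ← sup_assoc]
    refine (quotLength_sup_span_pow_le _ _ _).trans ?_
    rw [sup_right_comm, pow_succ', Nat.cast_mul, mul_assoc]
    exact mul_le_mul_right (ih _) _

/-- The `k`-th power contains the `k`-th powers of the generators, and raising one generator to the
power `k` multiplies the length bound by at most `k`. Growth is thus bounded by a power whose
exponent is the number of generators. -/
lemma quotLength_span_pow_le (k : ℕ) (s : Finset R) :
    quotLength (Ideal.span (s : Set R) ^ k)
      ≤ (k ^ s.card : ℕ) * quotLength (Ideal.span (s : Set R)) := by
  classical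
  have h := quotLength_sup_span_image_pow_le k s ⊥
  rw [bot_sup_eq, bot_sup_eq] at h
  refine (quotLength_anti (Ideal.span_le.2 ?_)).trans h
  rintro _ ⟨x, hx, rfl⟩
  exact Ideal.pow_mem_pow (Ideal.subset_span hx) k

end Colength

/-! ### Graded submodules of multi-Rees algebras -/

section Families

variable {R : Type*} [CommRing R] {ι : Type*} [Fintype ι]

/-- The ideal `∏ 𝓘 i ^ k i`. -/
def mpow (𝓘 : ι → Ideal R) (k : ι → ℕ) : Ideal R := ∏ i, 𝓘 i ^ k i

lemma mpow_add (𝓘 : ι → Ideal R) (k l : ι → ℕ) : mpow 𝓘 (k + l) = mpow 𝓘 k * mpow 𝓘 l := by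
  simp only [mpow, Pi.add_apply, pow_add, Finset.prod_mul_distrib]

lemma mpow_single [DecidableEq ι] (𝓘 : ι → Ideal R) (j : ι) (a : ℕ) : mpow 𝓘 (Pi.single j a) = 𝓘 j ^ a := by
  rw [mpow, Finset.prod_eq_single j]
  · rw [Pi.single_eq_same]
  · intro i _ hi
    rw [Pi.single_eq_of_ne hi, pow_zero]
  · exact fun h => absurd (Finset.mem_univ _) h

lemma mpow_add_single [DecidableEq ι] (𝓘 : ι → Ideal R) (k : ι → ℕ) (j : ι) :
    mpow 𝓘 (k + Pi.single j 1) = 𝓘 j * mpow 𝓘 k := by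
  rw [mpow_add, mpow_single, pow_one, mul_comm]

lemma mpow_anti (𝓘 : ι → Ideal R) {k l : ι → ℕ} (h : k ≤ l) : mpow 𝓘 l ≤ mpow 𝓘 k := by
  rw [← add_tsub_cancel_of_le h, mpow_add]
  exact Ideal.mul_le_left (I := mpow 𝓘 k) (J := mpow 𝓘 (l - k))

variable [DecidableEq ι]

/-- A multigraded submodule `⨁ N k` of the module `⨁ L * mpow 𝓘 k` over the Rees algebra
of `𝓘`. -/
structure IsReesFamily (𝓘 : ι → Ideal R) (L : Ideal R) (N : (ι → ℕ) → Ideal R) : Prop where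
  le : ∀ k, N k ≤ L * mpow 𝓘 k
  mul_le : ∀ j k, 𝓘 j * N k ≤ N (k + Pi.single j 1)

section Noetherian

open MvPolynomial

variable {𝓘 : ι → Ideal R} {L : Ideal R}

/-- The presentation of the Rees algebra of `𝓘` inside the polynomial ring, given by generating
sets `G i` of the ideals. -/
def reesMap (G : ι → Finset R) : MvPolynomial (Σ i, G i) R →ₐ[R] MvPolynomial ι R :=
  aeval fun p => monomial (Finsupp.single p.1 1) (p.2 : R)

lemma monomial_mem_range_reesMap (G : ι → Finset R)
    (hG : ∀ i, Ideal.span (G i : Set R) = 𝓘 i) (d : ℕ) :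
    ∀ k : ι →₀ ℕ, k.degree = d → ∀ y ∈ mpow 𝓘 k, monomial k y ∈ (reesMap G).range := by
  have hadd : ∀ (k : ι →₀ ℕ) (I : Ideal R), (∀ y ∈ I, monomial k y ∈ (reesMap G).range) ↔
      I ≤ Submodule.comap (monomial k) (Subalgebra.toSubmodule (reesMap G).range) :=
    fun k I => Iff.rfl
  induction d with
  | zero =>
    intro k hk y _
    have : k = 0 := (Finsupp.degree_eq_zero_iff k).1 hk
    subst this
    exact (reesMap G).range.algebraMap_mem y
  | succ d ih =>
    intro k hk
    obtain ⟨j, t, rfl, ht⟩ : ∃ (i : ι) (t : ι →₀ ℕ), k = Finsupp.single i 1 + t ∧ t.degree = d :=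
      exists_eq_add_single hk
    rw [hadd, add_comm, Finsupp.coe_add, Finsupp.single_eq_pi_single, mpow_add_single, Ideal.mul_le]
    intro r hr s hs
    have h1 : 𝓘 j ≤ Submodule.comap (monomial (Finsupp.single j 1))
        (Subalgebra.toSubmodule (reesMap G).range) := by
      rw [← hG j]
      refine Submodule.span_le.2 fun x hx => ?_
      exact ⟨X ⟨j, ⟨x, hx⟩⟩, by simp [reesMap]⟩
    have h2 := (reesMap G).range.mul_mem (h1 hr) (ih t ht s hs)
    rw [monomial_mul, add_comm] at h2
    exact h2

lemma IsReesFamily.coeff_reesMap_mul_mem (G : ι → Finset R)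
    (hG : ∀ i, Ideal.span (G i : Set R) = 𝓘 i) {N : (ι → ℕ) → Ideal R}
    (hN : IsReesFamily 𝓘 L N) (t : MvPolynomial (Σ i, G i) R) :
    ∀ s, (∀ k : ι →₀ ℕ, coeff k (reesMap G s) ∈ N k) →
      ∀ k : ι →₀ ℕ, coeff k (reesMap G (t * s)) ∈ N k := by
  induction t using MvPolynomial.induction_on with
  | C a =>
    intro s hs k
    rw [map_mul, ← algebraMap_eq, AlgHom.commutes, algebraMap_eq, coeff_C_mul]
    exact Ideal.mul_mem_left _ _ (hs k)
  | add p q hp hq =>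
    intro s hs k
    rw [add_mul, map_add, coeff_add]
    exact add_mem (hp s hs k) (hq s hs k)
  | mul_X p v hp =>
    intro s hs
    rw [mul_assoc]
    refine hp _ fun k => ?_
    obtain ⟨j, x, hx⟩ := v
    rw [map_mul, show reesMap G (X ⟨j, x, hx⟩) = monomial (Finsupp.single j 1) x by simp [reesMap],
      coeff_monomial_mul']
    split_ifs with h
    · obtain ⟨l, rfl⟩ := exists_add_of_le h
      rw [add_tsub_cancel_left, add_comm (Finsupp.single j 1) l, Finsupp.coe_add,
        Finsupp.single_eq_pi_single]
      refine hN.mul_le j _ (Ideal.mul_mem_mul ?_ (hs _))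
      rw [← hG j]
      exact Ideal.subset_span hx
    · exact zero_mem _

/-- The ideal of polynomials whose images in the Rees algebra lie in the family `N`. -/
def IsReesFamily.toIdeal (G : ι → Finset R)
    (hG : ∀ i, Ideal.span (G i : Set R) = 𝓘 i) {N : (ι → ℕ) → Ideal R}
    (hN : IsReesFamily 𝓘 L N) : Ideal (MvPolynomial (Σ i, G i) R) where
  carrier := {s | ∀ k : ι →₀ ℕ, coeff k (reesMap G s) ∈ N k}
  add_mem' := fun ha hb k => by
    rw [map_add, coeff_add]
    exact add_mem (ha k) (hb k)
  zero_mem' := fun k => by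
    rw [map_zero, coeff_zero]
    exact zero_mem _
  smul_mem' := fun t s hs => hN.coeff_reesMap_mul_mem G hG t s hs

/-- Pulled back along `reesMap`, a family becomes an ideal in a polynomial ring over `R` in finitely
many variables, which is Noetherian. Strict inclusions stay strict because every monomial with
coefficient in `mpow 𝓘 k` has a preimage. -/
instance IsReesFamily.wellFoundedGT [IsNoetherianRing R] :
    WellFoundedGT {N : (ι → ℕ) → Ideal R // IsReesFamily 𝓘 L N} := by
  choose G hG using fun i => IsNoetherian.noetherian (𝓘 i)
  refine StrictMono.wellFoundedGT
    (f := fun N : {N : (ι → ℕ) → Ideal R // IsReesFamily 𝓘 L N} => N.2.toIdeal G hG) ?_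
  intro N N' hlt
  refine lt_of_le_not_ge (fun s hs k => hlt.le k (hs k)) fun hle => hlt.not_ge fun k y hy => ?_
  have hk : (k : ι → ℕ) = ⇑(Finsupp.equivFunOnFinite.symm k) := rfl
  rw [hk] at hy ⊢
  obtain ⟨s, hs⟩ := monomial_mem_range_reesMap G hG _ (Finsupp.equivFunOnFinite.symm k) rfl y
    (Ideal.mul_le_right (I := L) (J := mpow 𝓘 _) (N'.2.le _ hy))
  have h1 : s ∈ N'.2.toIdeal G hG := fun l => by
    rw [show reesMap G s = _ from hs, coeff_monomial]
    split_ifs with h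
    · rwa [← h]
    · exact zero_mem _
  have h2 := hle h1 (Finsupp.equivFunOnFinite.symm k)
  rw [show reesMap G s = _ from hs, coeff_monomial, if_pos rfl] at h2
  exact h2

end Noetherian

end Families

/-! ### The multigraded Hilbert theorem -/

section HilbertFunction

variable {R : Type*} [CommRing R] {ι : Type*} [Fintype ι] [DecidableEq ι]
  {𝓘 : ι → Ideal R} {L : Ideal R} {N : (ι → ℕ) → Ideal R}

/-- The family `(N : x)` for an element `x` of degree `e_j`. -/
def colonReesFamily (𝓘 : ι → Ideal R) (L : Ideal R) (N : (ι → ℕ) → Ideal R) (j : ι) (x : R) :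
    (ι → ℕ) → Ideal R :=
  fun k => L * mpow 𝓘 k ⊓ colonElem (N (k + Pi.single j 1)) x

/-- The family `N + x M` for an element `x` of degree `e_j`, where `M k = L * mpow 𝓘 k`. -/
def addReesFamily (𝓘 : ι → Ideal R) (L : Ideal R) (N : (ι → ℕ) → Ideal R) (j : ι) (x : R) :
    (ι → ℕ) → Ideal R :=
  fun k => N k ⊔ Ideal.span {x} * (L * mpow 𝓘 (k - Pi.single j 1))

lemma IsReesFamily.colonFamily (hN : IsReesFamily 𝓘 L N) (j : ι) (x : R) :
    IsReesFamily 𝓘 L (colonReesFamily 𝓘 L N j x) where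
  le _ := inf_le_left
  mul_le i k := by
    rw [Ideal.mul_le]
    intro r hr s hs
    refine ⟨?_, ?_⟩
    · rw [mpow_add_single, mul_left_comm]
      exact Ideal.mul_mem_mul hr hs.1
    · rw [SetLike.mem_coe, mem_colonElem, add_right_comm, mul_left_comm]
      exact hN.mul_le i _ (Ideal.mul_mem_mul hr hs.2)

lemma IsReesFamily.le_colonFamily (hN : IsReesFamily 𝓘 L N) {j : ι} {x : R} (hx : x ∈ 𝓘 j) :
    N ≤ colonReesFamily 𝓘 L N j x :=
  fun k _ hy => ⟨hN.le k hy, hN.mul_le j k (Ideal.mul_mem_mul hx hy)⟩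

lemma IsReesFamily.addFamily (hN : IsReesFamily 𝓘 L N) {j : ι} {x : R} (hx : x ∈ 𝓘 j) :
    IsReesFamily 𝓘 L (addReesFamily 𝓘 L N j x) where
  le k := by
    refine sup_le (hN.le k) ?_
    rw [mul_left_comm]
    refine Ideal.mul_mono_right ?_
    refine (Ideal.mul_mono_left ((Ideal.span_singleton_le_iff_mem _).2 hx)).trans ?_
    rw [← mpow_add_single]
    exact mpow_anti 𝓘 le_tsub_add
  mul_le i k := by
    rw [addReesFamily, Ideal.mul_sup]
    refine sup_le_sup (hN.mul_le i k) ?_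
    rw [mul_left_comm]
    refine Ideal.mul_mono_right ?_
    rw [mul_left_comm, ← mpow_add_single]
    exact Ideal.mul_mono_right (mpow_anti 𝓘 add_tsub_le_tsub_add)

/-- The Hilbert function `k ↦ length (L * mpow 𝓘 k / N k)`. -/
def hilbertFn (𝓘 : ι → Ideal R) (L : Ideal R) (N : (ι → ℕ) → Ideal R) (k : ι → ℕ) : ℚ :=
  (colength (N k) : ℚ) - colength (L * mpow 𝓘 k)

lemma IsReesFamily.hilbertFn_eq_natCast (hN : IsReesFamily 𝓘 L N) (hfin : ∀ k, quotLength (N k) ≠ ⊤)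
    (k : ι → ℕ) : ∃ c : ℕ, hilbertFn 𝓘 L N k = c :=
  ⟨colength (N k) - colength (L * mpow 𝓘 k), by
    rw [Nat.cast_sub (colength_anti (hN.le k) (hfin k)), hilbertFn]⟩

/-- With `M k = L * mpow 𝓘 k`, multiplication by `x` maps `M k` to `M / N` in degree `k + e_j`. Its
image is `M k` modulo the colon family, and its cokernel is `M / (N + xM)`. -/
lemma IsReesFamily.hilbertFn_add_single (hN : IsReesFamily 𝓘 L N)
    (hfin : ∀ k, quotLength (N k) ≠ ⊤) {j : ι} {x : R} (hx : x ∈ 𝓘 j) (k : ι → ℕ) :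
    hilbertFn 𝓘 L N (k + Pi.single j 1) = hilbertFn 𝓘 L (colonReesFamily 𝓘 L N j x) k
      + hilbertFn 𝓘 L (addReesFamily 𝓘 L N j x) (k + Pi.single j 1) := by
  have h := quotLength_add_quotLength (N (k + Pi.single j 1)) (L * mpow 𝓘 k) x
  have hM : quotLength (L * mpow 𝓘 k) ≠ ⊤ := quotLength_ne_top_of_le (hN.le k) (hfin k)
  have hS : quotLength (N (k + Pi.single j 1) ⊔ Ideal.span {x} * (L * mpow 𝓘 k)) ≠ ⊤ :=
    quotLength_ne_top_of_le le_sup_left (hfin _)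
  have hC : quotLength (L * mpow 𝓘 k ⊓ colonElem (N (k + Pi.single j 1)) x) ≠ ⊤ :=
    quotLength_ne_top_of_le (hN.le_colonFamily hx k) (hfin k)
  have h' := congrArg ENat.toNat h
  rw [ENat.toNat_add (hfin _) hM, ENat.toNat_add hS hC] at h'
  have h'' : (colength (N (k + Pi.single j 1)) : ℚ) + colength (L * mpow 𝓘 k)
      = colength (N (k + Pi.single j 1) ⊔ Ideal.span {x} * (L * mpow 𝓘 k))
        + colength (L * mpow 𝓘 k ⊓ colonElem (N (k + Pi.single j 1)) x) := by
    exact_mod_cast h'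
  simp only [hilbertFn, colonReesFamily, addReesFamily, add_tsub_cancel_right]
  linarith

/-- The multigraded Hilbert theorem for subquotients of Rees algebras: the Hilbert function is
eventually polynomial, with top-degree coefficients satisfying `TopNat`. -/
theorem IsReesFamily.exists_hilbertPolynomial [IsNoetherianRing R] (hN : IsReesFamily 𝓘 L N)
    (hfin : ∀ k, quotLength (N k) ≠ ⊤) :
    ∃ P, EventuallyEval (hilbertFn 𝓘 L N) P ∧ TopNat P := by
  suffices H : ∀ N : {N : (ι → ℕ) → Ideal R // IsReesFamily 𝓘 L N},
      (∀ k, quotLength (N.1 k) ≠ ⊤) → ∃ P, EventuallyEval (hilbertFn 𝓘 L N.1) P ∧ TopNat P from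
    H ⟨N, hN⟩ hfin

  intro N
  induction N using WellFoundedGT.induction with
  | ind N ih =>
  obtain ⟨N, hN⟩ := N
  intro hfin
  change ∀ k, quotLength (N k) ≠ ⊤ at hfin
  change ∃ P, EventuallyEval (hilbertFn 𝓘 L N) P ∧ TopNat P
  have ihN : ∀ N' : (ι → ℕ) → Ideal R, IsReesFamily 𝓘 L N' → N ≤ N' → N ≠ N' →
      ∃ P, EventuallyEval (hilbertFn 𝓘 L N') P ∧ TopNat P := fun N' hN' hle hne =>
    ih ⟨N', hN'⟩ (lt_of_le_of_ne hle fun h => hne (congrArg Subtype.val h))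
      fun k => quotLength_ne_top_of_le (hle k) (hfin k)
  -- If some `x` strictly enlarges both the colon and the sum family, induction applies to both
  -- terms of the length formula.
  by_cases hmid : ∃ j, ∃ x ∈ 𝓘 j, N ≠ colonReesFamily 𝓘 L N j x ∧ N ≠ addReesFamily 𝓘 L N j x
  · obtain ⟨j, x, hx, h1, h2⟩ := hmid
    obtain ⟨P₁, hP₁, hT₁⟩ := ihN _ (hN.colonFamily j x) (hN.le_colonFamily hx) h1
    obtain ⟨P₂, hP₂, hT₂⟩ := ihN _ (hN.addFamily hx) (fun k => le_sup_left) h2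
    have h3 : EventuallyEval (fun k => hilbertFn 𝓘 L N (k + Pi.single j 1))
        (P₁ + translate (Pi.single j 1) P₂) := by
      rw [funext fun k => hN.hilbertFn_add_single hfin hx k]
      exact hP₁.add (hP₂.shift j)
    exact ⟨_, h3.unshift, (hT₁.add (hT₂.translate _)).translate _⟩
  push Not at hmid
  -- From here each `x ∈ 𝓘 j` leaves the colon or the sum family equal to `N`. If the sum family
  -- never grows for some `j`, then `N` contains everything in degrees with `k j ≥ 1`, so the
  -- Hilbert function is eventually zero.
  by_cases hkill : ∃ j, ∀ x ∈ 𝓘 j, N = addReesFamily 𝓘 L N j x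
  · obtain ⟨j, hj⟩ := hkill
    refine ⟨0, ⟨1, fun k hk => ?_⟩, fun β _ => ⟨0, by simp⟩⟩
    have hk1 : k = (k - Pi.single j 1) + Pi.single j 1 := by
      refine (tsub_add_cancel_of_le fun i => ?_).symm
      by_cases h : i = j
      · subst h; simpa using hk i
      · simp [Pi.single_eq_of_ne h]
    have hle : L * mpow 𝓘 k ≤ N k := by
      conv_lhs => rw [hk1]
      rw [mpow_add_single, mul_left_comm, Ideal.mul_le]
      intro r hr s hs
      rw [hj r hr]
      exact Submodule.mem_sup_right (Ideal.mul_mem_mul (Ideal.mem_span_singleton_self r) hs)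
    rw [hilbertFn, le_antisymm (hN.le k) hle, sub_self, evalNat, map_zero]
  · push Not at hkill
    -- Otherwise each `j` has an `x` acting injectively modulo `N` (colon family equal to `N`). The
    -- `j`-th difference is then the Hilbert function of a strictly larger family.
    have hdiff : ∀ j, ∃ Q, EventuallyEval
        (fun k => hilbertFn 𝓘 L N (k + Pi.single j 1) - hilbertFn 𝓘 L N k) Q ∧ TopNat Q := by
      intro j
      obtain ⟨x, hx, hne⟩ := hkill j
      have hcol : N = colonReesFamily 𝓘 L N j x := by
        by_contra h
        exact hne (hmid j x hx h)
      obtain ⟨Q, hQ, hT⟩ := ihN _ (hN.addFamily hx) (fun k => le_sup_left) hne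
      refine ⟨_, ?_, hT.translate (Pi.single j 1)⟩
      have : (fun k => hilbertFn 𝓘 L N (k + Pi.single j 1) - hilbertFn 𝓘 L N k)
          = fun k => hilbertFn 𝓘 L (addReesFamily 𝓘 L N j x) (k + Pi.single j 1) := by
        funext k
        rw [hN.hilbertFn_add_single hfin hx k, ← hcol, add_sub_cancel_left]
      rw [this]
      exact hQ.shift j
    obtain ⟨P, hP⟩ := exists_eventuallyEval_of_difference _ fun j =>
      let ⟨Q, hQ, _⟩ := hdiff j
      ⟨Q, hQ⟩
    exact ⟨P, hP, topNat_of_difference (hN.hilbertFn_eq_natCast hfin) hP hdiff⟩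

/-- The function `k ↦ length (R / mpow 𝓘 k)`. -/
def mixedHilbertFn (𝓘 : ι → Ideal R) (k : ι → ℕ) : ℚ := colength (mpow 𝓘 k)

theorem exists_mixedHilbertPolynomial [IsNoetherianRing R]
    (hfin : ∀ k, quotLength (mpow 𝓘 k) ≠ ⊤) :
    ∃ P, EventuallyEval (mixedHilbertFn 𝓘) P ∧ TopNat P := by
  have hdiff : ∀ j, ∃ Q, EventuallyEval
      (fun k => mixedHilbertFn 𝓘 (k + Pi.single j 1) - mixedHilbertFn 𝓘 k) Q ∧ TopNat Q := by
    intro j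
    -- The `j`-th difference is the length of `𝓘^k / 𝓘_j 𝓘^k`, a quotient of the Rees algebra
    -- itself.
    have hN : IsReesFamily 𝓘 ⊤ fun k => mpow 𝓘 (k + Pi.single j 1) :=
      { le := fun k => by
          rw [Ideal.top_mul]
          exact mpow_anti 𝓘 le_self_add
        mul_le := fun i k => by rw [add_right_comm, mpow_add_single 𝓘 _ i] }
    obtain ⟨Q, hQ, hT⟩ := hN.exists_hilbertPolynomial fun k => hfin _
    refine ⟨Q, ?_, hT⟩
    convert hQ using 2 with k
    rw [hilbertFn, Ideal.top_mul, mixedHilbertFn, mixedHilbertFn]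
  obtain ⟨P, hP⟩ := exists_eventuallyEval_of_difference _ fun j =>
    let ⟨Q, hQ, _⟩ := hdiff j
    ⟨Q, hQ⟩
  exact ⟨P, hP, topNat_of_difference (fun k => ⟨_, rfl⟩) hP hdiff⟩

/-- For `L ≤ L'`, the differences of colengths of `L * mpow 𝓘 k` and `L' * mpow 𝓘 k` are
eventually given by a polynomial with `TopNat`. -/
theorem exists_hilbertPolynomial_of_le [IsNoetherianRing R] {L L' : Ideal R} (h : L ≤ L')
    (hfin : ∀ k, quotLength (L * mpow 𝓘 k) ≠ ⊤) :
    ∃ P, EventuallyEval (fun k => (colength (L * mpow 𝓘 k) : ℚ) - colength (L' * mpow 𝓘 k)) P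
      ∧ TopNat P :=
  IsReesFamily.exists_hilbertPolynomial (N := fun k => L * mpow 𝓘 k) (L := L')
    { le := fun k => Ideal.mul_mono_left h
      mul_le := fun j k => by rw [mpow_add_single, mul_left_comm] } hfin

end HilbertFunction

/-! ### Degree of the Hilbert polynomial, and mixed multiplicities as its coefficients -/

section MixedMultiplicities

open MvPolynomial

variable {R : Type*} [CommRing R] [IsLocalRing R]

/-- An ideal between some power of the maximal ideal and the maximal ideal. -/
structure IsMPrimary (I : Ideal R) : Prop where
  le : I ≤ maximalIdeal R
  exists_pow_le : ∃ c : ℕ, maximalIdeal R ^ c ≤ I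

lemma isMPrimary_maximalIdeal : IsMPrimary (maximalIdeal R) :=
  ⟨le_rfl, 1, (pow_one _).le⟩

lemma IsMPrimary.pow {I : Ideal R} (hI : IsMPrimary I) {a : ℕ} (ha : 1 ≤ a) :
    IsMPrimary (I ^ a) := by
  obtain ⟨c, hc⟩ := hI.exists_pow_le
  refine ⟨(Ideal.pow_le_self (by omega)).trans hI.le, c * a, ?_⟩
  rw [pow_mul]
  exact Ideal.pow_right_mono hc a

lemma IsMPrimary.sup {I J : Ideal R} (hI : IsMPrimary I) (hJ : IsMPrimary J) :
    IsMPrimary (I ⊔ J) := by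
  obtain ⟨c, hc⟩ := hI.exists_pow_le
  exact ⟨sup_le hI.le hJ.le, c, hc.trans le_sup_left⟩

lemma isMPrimary_of_radical [IsNoetherianRing R] {I : Ideal R}
    (hI : I.radical = maximalIdeal R) : IsMPrimary I :=
  ⟨hI ▸ Ideal.le_radical,
    hI ▸ I.exists_radical_pow_le_of_fg (IsNoetherian.noetherian _)⟩

lemma quotLength_ne_top_of_mem_minimalPrimes [IsNoetherianRing R] {Q : Ideal R}
    (hQ : maximalIdeal R ∈ Q.minimalPrimes) : quotLength Q ≠ ⊤ := by
  have := IsLocalRing.quotient_artinian_of_mem_minimalPrimes_of_isLocalRing Q hQ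
  rw [quotLength, Module.length_eq_of_surjective (R := R ⧸ Q) Ideal.Quotient.mk_surjective]
  exact Module.length_ne_top

/-- `Q` is generated by a system of parameters: `n` elements over whose ideal `𝔪` is minimal. -/
lemma exists_quotLength_pow_le [IsNoetherianRing R] {n : ℕ} (hn : ringKrullDim R = n) :
    ∃ (Q : Ideal R) (ℓ : ℕ), Q ≤ maximalIdeal R ∧
      ∀ k : ℕ, quotLength (Q ^ k) ≤ ((k ^ n * ℓ : ℕ) : ℕ∞) := by
  obtain ⟨s, hs, hcard⟩ :=
    Ideal.exists_finset_card_eq_height_of_isNoetherianRing (maximalIdeal R)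
  have hcard' : s.card = n := by
    have h1 := IsLocalRing.maximalIdeal_height_eq_ringKrullDim (R := R)
    rw [← hcard, hn] at h1
    exact_mod_cast h1
  have hfin := quotLength_ne_top_of_mem_minimalPrimes hs
  refine ⟨Ideal.span s, (quotLength (Ideal.span (s : Set R))).toNat, hs.1.2, fun k => ?_⟩
  rw [Nat.cast_mul, ENat.natCast_toNat hfin, ← hcard']
  exact quotLength_span_pow_le k s

lemma IsMPrimary.quotLength_ne_top [IsNoetherianRing R] {I : Ideal R}
    (hI : ∃ c, maximalIdeal R ^ c ≤ I) : quotLength I ≠ ⊤ := by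
  obtain ⟨c, hc⟩ := hI
  obtain ⟨n, hn⟩ : ∃ n : ℕ, ringKrullDim R = n := by
    have h1 := IsLocalRing.maximalIdeal_height_eq_ringKrullDim (R := R)
    obtain ⟨s, -, hcard⟩ :=
      Ideal.exists_finset_card_eq_height_of_isNoetherianRing (maximalIdeal R)
    exact ⟨s.card, by rw [← h1, ← hcard]; rfl⟩
  obtain ⟨Q, ℓ, hQ, hb⟩ := exists_quotLength_pow_le hn
  exact quotLength_ne_top_of_le ((Ideal.pow_right_mono hQ c).trans hc)
    (ne_top_of_le_ne_top (ENat.natCast_ne_top _) (hb c))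

variable {ι : Type*} [Fintype ι]

lemma exists_uniform_pow_le {𝓘 : ι → Ideal R} (h𝓘 : ∀ i, IsMPrimary (𝓘 i)) :
    ∃ c : ℕ, ∀ i, maximalIdeal R ^ c ≤ 𝓘 i := by
  choose c hc using fun i => (h𝓘 i).exists_pow_le
  exact ⟨Finset.univ.sup c, fun i =>
    (Ideal.pow_le_pow_right (Finset.le_sup (Finset.mem_univ i))).trans (hc i)⟩

lemma pow_le_mpow {𝓘 : ι → Ideal R} {c : ℕ} (hc : ∀ i, maximalIdeal R ^ c ≤ 𝓘 i) (k : ι → ℕ) :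
    maximalIdeal R ^ (c * ∑ i, k i) ≤ mpow 𝓘 k := by
  rw [Finset.mul_sum, ← Finset.prod_pow_eq_pow_sum, mpow]
  refine Finset.prod_le_prod' fun i _ => ?_
  rw [pow_mul]
  exact Ideal.pow_right_mono (hc i) _

lemma exists_pow_le_mpow {𝓘 : ι → Ideal R} (h𝓘 : ∀ i, IsMPrimary (𝓘 i)) (k : ι → ℕ) :
    ∃ c : ℕ, maximalIdeal R ^ c ≤ mpow 𝓘 k := by
  obtain ⟨c, hc⟩ := exists_uniform_pow_le h𝓘
  exact ⟨_, pow_le_mpow hc k⟩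

variable [IsNoetherianRing R]

lemma quotLength_mpow_ne_top {𝓘 : ι → Ideal R} (h𝓘 : ∀ i, IsMPrimary (𝓘 i)) (k : ι → ℕ) :
    quotLength (mpow 𝓘 k) ≠ ⊤ :=
  IsMPrimary.quotLength_ne_top (exists_pow_le_mpow h𝓘 k)

/-- The multigraded Hilbert polynomial of `𝔪`-primary ideals exists, with total degree at most
the dimension. -/
theorem exists_mixedHilbertPolynomial_degLT [DecidableEq ι] {n : ℕ} (hn : ringKrullDim R = n)
    {𝓘 : ι → Ideal R} (h𝓘 : ∀ i, IsMPrimary (𝓘 i)) :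
    ∃ P, EventuallyEval (mixedHilbertFn 𝓘) P ∧ TopNat P ∧ P ∈ degLT ι (n + 1) := by
  obtain ⟨P, hP, hT⟩ := exists_mixedHilbertPolynomial (quotLength_mpow_ne_top h𝓘)
  refine ⟨P, hP, hT, ?_⟩
  obtain ⟨K, hK⟩ := hP
  obtain ⟨c, hc⟩ := exists_uniform_pow_le h𝓘
  obtain ⟨Q, ℓ, hQ, hb⟩ := exists_quotLength_pow_le hn
  -- Since `Q ≤ 𝔪` and `𝔪^(c ∑ k) ≤ mpow 𝓘 k`, the colength is at most `(c ∑ k)^n ℓ`, a polynomial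
  -- of degree at most `n`.
  let E : MvPolynomial ι ℚ := (C (c : ℚ) * ∑ i, X i) ^ n * C (ℓ : ℚ)
  have hE : E ∈ degLT ι (n + 1) := by
    refine mem_degLT_of_totalDegree_lt (Nat.lt_succ_of_le ?_)
    refine (totalDegree_mul _ _).trans ?_
    rw [totalDegree_C, add_zero]
    refine (totalDegree_pow _ _).trans ?_
    refine (Nat.mul_le_mul_left n (?_ : _ ≤ 1)).trans (mul_one n).le
    refine (totalDegree_mul _ _).trans ?_
    rw [totalDegree_C, zero_add]
    exact (totalDegree_finsetSum _ _).trans (Finset.sup_le fun i _ => (totalDegree_X i).le)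
  refine mem_degLT_of_le hE K (fun k hk => ?_) fun k hk => ?_
  · rw [hK k hk, mixedHilbertFn]
    exact Nat.cast_nonneg _
  · rw [hK k hk, mixedHilbertFn]
    have h1 : Q ^ (c * ∑ i, k i) ≤ mpow 𝓘 k :=
      (Ideal.pow_right_mono hQ _).trans (pow_le_mpow hc k)
    have h2 : colength (mpow 𝓘 k) ≤ (c * ∑ i, k i) ^ n * ℓ :=
      ENat.toNat_le_of_le_natCast ((quotLength_anti h1).trans (hb _))
    have h3 : evalNat E k = (((c * ∑ i, k i) ^ n * ℓ : ℕ) : ℚ) := by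
      simp [E, evalNat]
    rw [h3]
    exact_mod_cast h2

/-- The exponent `(1, …, 1)`. -/
abbrev onesExp (n : ℕ) : Fin n →₀ ℕ := Finsupp.equivFunOnFinite.symm fun _ => 1

lemma degree_mapDomain_onesExp {ι : Type*} {n : ℕ} (f : Fin n → ι) :
    (Finsupp.mapDomain f (onesExp n)).degree = n := by
  rw [Finsupp.degree_mapDomain, Finsupp.degree_eq_sum]
  simp

lemma degree_onesExp (n : ℕ) : (onesExp n).degree = n := by
  rw [Finsupp.degree_eq_sum]
  simp

lemma mixedMultiplicity_eq_coeff {n : ℕ} (hn : ringKrullDim R = n) {I : Fin n → Ideal R}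
    (hI : ∀ j, IsMPrimary (I j)) {P : MvPolynomial (Fin n) ℚ}
    (hP : EventuallyEval (mixedHilbertFn I) P) :
    (mixedMultiplicity I : ℚ) = P.coeff (onesExp n) := by
  obtain ⟨P', hP', hT, hdeg⟩ := exists_mixedHilbertPolynomial_degLT hn hI
  obtain rfl := hP'.unique hP
  obtain ⟨c, hc⟩ := hT (onesExp n) (by rwa [degree_onesExp])
  have hc' : P'.coeff (onesExp n) = c := by rw [← hc]; simp
  have hset : {e : ℕ | ∃ P : MvPolynomial (Fin n) ℚ, IsMixedHilbertPolynomial I P ∧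
      P.coeff (Finsupp.equivFunOnFinite.symm (fun _ => 1)) = (e : ℚ)} = {c} := by
    ext e
    constructor
    · rintro ⟨P, hP, he⟩
      obtain rfl : P = P' := EventuallyEval.unique (H := mixedHilbertFn I) hP hP'
      exact_mod_cast he.symm.trans hc'
    · rintro rfl
      exact ⟨P', hP', hc'⟩
  rw [mixedMultiplicity, hset, csInf_singleton, hc']

lemma eval_killCompl {σ τ : Type*} {f : σ → τ} (hf : Function.Injective f) (y : σ → ℚ)
    (P : MvPolynomial τ ℚ) :
    eval y (killCompl hf P) = eval (Function.extend f y 0) P := by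
  induction P using MvPolynomial.induction_on with
  | C a => rw [killCompl_C, eval_C, eval_C]
  | add p q hp hq => rw [map_add, map_add, map_add, hp, hq]
  | mul_X p i hp =>
    rw [map_mul, map_mul, map_mul, hp, eval_X]
    congr 1
    by_cases h : ∃ j, f j = i
    · obtain ⟨j, rfl⟩ := h
      rw [← rename_X f j, killCompl_rename_app, eval_X, hf.extend_apply]
    · rw [Function.extend_apply' _ _ _ h, killCompl, aeval_X,
        dif_neg (show i ∉ Set.range f from h), map_zero, Pi.zero_apply]

/-- The mixed multiplicity of a subfamily of `n` ideals is a coefficient of the Hilbert polynomial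
of the whole family. -/
theorem coeff_mapDomain_eq_mixedMultiplicity [DecidableEq ι] {n : ℕ} (hn : ringKrullDim R = n)
    (hn0 : 0 < n) {𝓘 : ι → Ideal R} (h𝓘 : ∀ i, IsMPrimary (𝓘 i)) {f : Fin n → ι}
    (hf : Function.Injective f) {P : MvPolynomial ι ℚ} (hP : EventuallyEval (mixedHilbertFn 𝓘) P)
    (hdeg : P ∈ degLT ι (n + 1)) :
    P.coeff (Finsupp.mapDomain f (onesExp n)) = mixedMultiplicity fun j => 𝓘 (f j) := by
  obtain ⟨K, hK⟩ := hP
  obtain ⟨P', hP', -, hdeg'⟩ := exists_mixedHilbertPolynomial_degLT hn fun j => h𝓘 (f j)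
  have hmm := mixedMultiplicity_eq_coeff hn (fun j => h𝓘 (f j)) hP'
  obtain ⟨K', hK'⟩ := hP'
  -- Fixing the exponents outside the range of `f` at `K` multiplies the products of the subfamily
  -- by one fixed ideal `B`. The translation by `v` leaves top-degree coefficients unchanged.
  set v : ι → ℚ := Function.extend f 0 (fun _ => (K : ℚ)) with hv
  set Q := killCompl hf (translate v P) with hQ
  set B := mpow 𝓘 (Function.extend f 0 (fun _ => K)) with hB
  have hQeval : ∀ y : Fin n → ℕ, (∀ j, K ≤ y j) →
      evalNat Q y = colength (mpow (fun j => 𝓘 (f j)) y * B) := by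
    intro y hy
    have h1 : evalNat Q y = evalNat P (Function.extend f y (fun _ => K)) := by
      rw [evalNat, hQ, eval_killCompl, eval_translate, evalNat]
      congr 2
      funext i
      by_cases h : ∃ j, f j = i
      · obtain ⟨j, rfl⟩ := h
        rw [hv, hf.extend_apply, hf.extend_apply, hf.extend_apply, Pi.zero_apply, add_zero]
      · rw [hv, Function.extend_apply' _ _ _ h, Function.extend_apply' _ _ _ h,
          Function.extend_apply' _ _ _ h, Pi.zero_apply, zero_add]
    rw [h1, hK _ fun i => ?_, mixedHilbertFn]
    · congr 2
      have h2 : Function.extend f y (fun _ => K)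
          = Function.extend f y 0 + Function.extend f 0 (fun _ => K) := by
        funext i
        by_cases h : ∃ j, f j = i
        · obtain ⟨j, rfl⟩ := h
          simp [hf.extend_apply]
        · simp [Function.extend_apply' _ _ _ h]
      rw [h2, mpow_add, ← hB]
      congr 1
      rw [mpow, mpow]
      symm
      refine Finset.prod_of_injOn f hf.injOn (by simp) (fun i _ hi => ?_) fun j _ => ?_
      · rw [Function.extend_apply' _ _ _ (by simpa using hi), Pi.zero_apply, pow_zero]
      · rw [hf.extend_apply]
    · by_cases h : ∃ j, f j = i
      · obtain ⟨j, rfl⟩ := h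
        rw [hf.extend_apply]
        exact hy j
      · rw [Function.extend_apply' _ _ _ h]
  set j₀ : Fin n := ⟨0, hn0⟩
  obtain ⟨t, ht⟩ : ∃ t, 𝓘 (f j₀) ^ t ≤ B := by
    obtain ⟨c, hc⟩ := exists_pow_le_mpow h𝓘 (Function.extend f 0 (fun _ => K))
    exact ⟨c, (Ideal.pow_right_mono (h𝓘 _).le c).trans hc⟩
  -- As `𝓘 (f j₀)^t ≤ B`, one has `P'(y) ≤ Q(y) ≤ P'(y + t e_{j₀})` for large `y`. The outer terms
  -- differ by a polynomial of degree below `n`, so `Q` and `P'` agree in degree `n`.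
  have hD : Q - P' ∈ degLT (Fin n) n := by
    refine mem_degLT_of_le (translate_sub_mem (Pi.single j₀ (t : ℚ)) hdeg') (max K K')
      (fun y hy => ?_) fun y hy => ?_
    · have hy1 := fun j => (le_max_left K K').trans (hy j)
      have hy2 := fun j => (le_max_right K K').trans (hy j)
      rw [evalNat, map_sub, sub_nonneg]
      have h1 := hQeval y hy1
      have h2 := hK' y hy2
      rw [evalNat] at h1 h2
      rw [h1, h2, mixedHilbertFn, Nat.cast_le]
      refine colength_anti Ideal.mul_le_left (IsMPrimary.quotLength_ne_top ?_)
      obtain ⟨c, hc⟩ := exists_pow_le_mpow (fun j => h𝓘 (f j)) y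
      obtain ⟨d, hd⟩ := exists_pow_le_mpow h𝓘 (Function.extend f 0 (fun _ => K))
      exact ⟨c + d, by rw [pow_add]; exact Ideal.mul_mono hc hd⟩
    · have hy1 := fun j => (le_max_left K K').trans (hy j)
      have hy2 := fun j => (le_max_right K K').trans (hy j)
      have h1 := hQeval y hy1
      have h3 := hK' (y + Pi.single j₀ t) fun j => (hy2 j).trans (Nat.le_add_right _ _)
      rw [evalNat, evalNat, map_sub, map_sub, sub_le_sub_iff_right, eval_translate]
      have h4 : (fun i => (y i : ℚ) + (Pi.single j₀ (t : ℚ) : Fin n → ℚ) i)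
          = fun i => (((y + Pi.single j₀ t : Fin n → ℕ) i : ℕ) : ℚ) := by
        funext i
        by_cases h : i = j₀
        · subst h; simp
        · simp [Pi.single_eq_of_ne h]
      rw [evalNat] at h1 h3
      rw [h4, h1, h3, mixedHilbertFn, Nat.cast_le]
      refine colength_anti ?_ (quotLength_mpow_ne_top (fun j => h𝓘 (f j)) _)
      rw [mpow_add, mpow_single]
      exact Ideal.mul_mono_right ht
  have hcoeff := hD (onesExp n) (degree_onesExp n).ge
  rw [coeff_sub, sub_eq_zero] at hcoeff
  rw [hmm, ← hcoeff, hQ, coeff_killCompl, coeff_translate_of_mem]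
  rwa [degree_mapDomain_onesExp]

end MixedMultiplicities

/-! ### Monotonicity, homogeneity, and the Samuel multiplicity -/

section Properties

open MvPolynomial

variable {R : Type*} [CommRing R] [IsLocalRing R] [IsNoetherianRing R] {n : ℕ}

lemma mixedMultiplicity_update_le (hn : ringKrullDim R = n) {I : Fin n → Ideal R}
    (hI : ∀ j, IsMPrimary (I j)) (j₀ : Fin n) {L : Ideal R} (hL : IsMPrimary L) (hle : I j₀ ≤ L) :
    mixedMultiplicity (Function.update I j₀ L) ≤ mixedMultiplicity I := by
  have hn0 : 0 < n := j₀.pos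
  -- With `L` adjoined at index `none`, both multiplicities become coefficients of one Hilbert
  -- polynomial.
  set 𝓘 : Option (Fin n) → Ideal R := fun o => o.elim L I with h𝓘def
  have h𝓘 : ∀ o, IsMPrimary (𝓘 o) := by
    rintro (_ | j)
    · exact hL
    · exact hI j
  obtain ⟨P, hP, -, hdeg⟩ := exists_mixedHilbertPolynomial_degLT hn h𝓘
  set f : Fin n → Option (Fin n) := fun j => if j = j₀ then none else some j with hf
  have hfinj : Function.Injective f := by
    intro a b hab
    simp only [hf] at hab
    split_ifs at hab with h1 h2 h2
    · rw [h1, h2]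
    · exact Option.some_injective _ hab
  have c1 := coeff_mapDomain_eq_mixedMultiplicity hn hn0 h𝓘
    (Option.some_injective (Fin n)) hP hdeg
  have c2 := coeff_mapDomain_eq_mixedMultiplicity hn hn0 h𝓘 hfinj hP hdeg
  have e2 : (fun j => 𝓘 (f j)) = Function.update I j₀ L := by
    funext j
    by_cases h : j = j₀
    · subst h; simp [hf, h𝓘def]
    · simp [hf, h𝓘def, h]
  rw [e2] at c2
  change _ = ((mixedMultiplicity I : ℕ) : ℚ) at c1
  set β : Option (Fin n) →₀ ℕ := Finsupp.mapDomain some (onesExp n) - Finsupp.single (some j₀) 1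
    with hβ
  have hones : ∀ j, Finsupp.mapDomain some (onesExp n) (some j) = 1 := fun j => by
    rw [Finsupp.mapDomain_apply (Option.some_injective _)]; rfl
  have hnone : Finsupp.mapDomain some (onesExp n) none = 0 :=
    Finsupp.mapDomain_of_notMem_range _ _ (by simp)
  have hβ1 : β + Finsupp.single (some j₀) 1 = Finsupp.mapDomain some (onesExp n) := by
    apply tsub_add_cancel_of_le
    rw [Finsupp.single_le_iff, hones]
  have hβ2 : β + Finsupp.single none 1 = Finsupp.mapDomain f (onesExp n) := by
    ext o
    rcases o with _ | j
    · have h1 : f j₀ = none := by simp [hf]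
      rw [← h1, Finsupp.mapDomain_apply hfinj, h1]
      simp [hβ, hnone]
    · by_cases h : j = j₀
      · subst h
        rw [Finsupp.mapDomain_of_notMem_range]
        · simp [hβ, hones]
        · rintro ⟨i, hi⟩
          simp only [hf] at hi
          split_ifs at hi with h
          exact h (Option.some_injective _ hi)
      · have h1 : f j = some j := by simp [hf, h]
        rw [← h1, Finsupp.mapDomain_apply hfinj, h1]
        have h2 : some j ≠ some j₀ := fun h' => h (Option.some_injective _ h')
        simp [hβ, hones, Finsupp.single_eq_of_ne h2]
  have hβdeg : β.degree + 1 = n := by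
    have := congrArg Finsupp.degree hβ1
    rwa [map_add, Finsupp.degree_single, degree_mapDomain_onesExp] at this
  have hfin : ∀ k, quotLength (I j₀ * mpow 𝓘 k) ≠ ⊤ := fun k => by
    have := quotLength_mpow_ne_top h𝓘 (k + Pi.single (some j₀) 1)
    rwa [mpow_add_single] at this
  obtain ⟨D, hD, hT⟩ := exists_hilbertPolynomial_of_le (𝓘 := 𝓘) hle hfin
  -- `D` gives the length of `L 𝓘^k / I_{j₀} 𝓘^k`. Its coefficient at `β`, of degree `n - 1`, is the
  -- difference of the two multiplicities, and `TopNat` makes it nonnegative.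
  have hDP : D = (translate (Pi.single (some j₀) 1) P - P)
      - (translate (Pi.single none 1) P - P) := by
    rw [sub_sub_sub_cancel_right]
    refine hD.unique ?_
    convert (hP.shift (some j₀)).sub (hP.shift none) using 2 with k
    rw [mixedHilbertFn, mixedHilbertFn, mpow_add_single, mpow_add_single]
    rfl
  have hdeg' : P ∈ degLT (Option (Fin n)) (β.degree + 2) := by
    rwa [show β.degree + 2 = n + 1 by omega]
  obtain ⟨c, hc⟩ := hT β (by
    rw [hDP]
    exact sub_mem (translate_sub_mem _ hdeg') (translate_sub_mem _ hdeg'))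
  have hβj : β (some j₀) = 0 := by simp [hβ, hones]
  have hβn : β none = 0 := by simp [hβ, hnone]
  rw [hDP, coeff_sub, coeff_translate_single_sub _ hdeg', coeff_translate_single_sub _ hdeg',
    hβ1, hβ2, c1, c2, hβj, hβn] at hc
  have hpos : (0 : ℚ) < ((∏ i, (β i).factorial : ℕ) : ℚ) :=
    Nat.cast_pos.2 (Finset.prod_pos fun i _ => Nat.factorial_pos _)
  have h0 : (0 : ℚ) ≤ (mixedMultiplicity I : ℚ) - mixedMultiplicity (Function.update I j₀ L) := by
    by_contra h
    have h1 := mul_neg_of_pos_of_neg hpos (not_le.1 h)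
    have h2 : (0 : ℚ) ≤ c := Nat.cast_nonneg c
    simp only [Nat.cast_zero, zero_add, mul_one] at hc
    linarith
  exact_mod_cast sub_nonneg.1 h0

/-- Mixed multiplicities are antitone in the ideals. -/
theorem mixedMultiplicity_anti (hn : ringKrullDim R = n) {I J : Fin n → Ideal R}
    (hI : ∀ j, IsMPrimary (I j)) (hJ : ∀ j, IsMPrimary (J j)) (h : ∀ j, I j ≤ J j) :
    mixedMultiplicity J ≤ mixedMultiplicity I := by
  have key : ∀ T : Finset (Fin n),
      mixedMultiplicity (fun j => if j ∈ T then J j else I j) ≤ mixedMultiplicity I := by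
    intro T
    induction T using Finset.induction_on with
    | empty => simp
    | insert a T ha ih =>
      refine le_trans ?_ ih
      have hup : (fun j => if j ∈ insert a T then J j else I j)
          = Function.update (fun j => if j ∈ T then J j else I j) a (J a) := by
        funext j
        by_cases hj : j = a
        · subst hj; simp
        · simp [hj]
      rw [hup]
      refine mixedMultiplicity_update_le hn (fun j => ?_) a (hJ a) ?_
      · split_ifs
        · exact hJ j
        · exact hI j
      · simp only [ha, if_false]
        exact h a
  simpa using key Finset.univ

/-- Mixed multiplicities are multihomogeneous. -/
theorem mixedMultiplicity_pow (hn : ringKrullDim R = n) {I : Fin n → Ideal R}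
    (hI : ∀ j, IsMPrimary (I j)) {a : Fin n → ℕ} (ha : ∀ j, 1 ≤ a j) :
    mixedMultiplicity (fun j => I j ^ a j) = (∏ j, a j) * mixedMultiplicity I := by
  obtain ⟨P, hP, -, -⟩ := exists_mixedHilbertPolynomial_degLT hn hI
  set S : MvPolynomial (Fin n) ℚ →ₐ[ℚ] MvPolynomial (Fin n) ℚ :=
    aeval fun j => C (a j : ℚ) * X j with hS
  have heval : ∀ k : Fin n → ℕ, evalNat (S P) k = evalNat P (fun j => a j * k j) := by
    intro k
    clear hP
    simp only [evalNat]
    induction P using MvPolynomial.induction_on with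
    | C a => simp [S]
    | add p q hp hq => rw [map_add, map_add, map_add, hp, hq]
    | mul_X p i hp => rw [map_mul, map_mul, map_mul, hp]; simp [S]
  have hQ : EventuallyEval (mixedHilbertFn fun j => I j ^ a j) (S P) := by
    obtain ⟨K, hK⟩ := hP
    refine ⟨K, fun k hk => ?_⟩
    rw [heval, hK _ fun j => (hk j).trans (Nat.le_mul_of_pos_left _ (ha j)), mixedHilbertFn,
      mixedHilbertFn, mpow, mpow]
    simp only [pow_mul]
  have hcoeff : (S P).coeff (onesExp n) = (∏ j, (a j : ℚ)) * P.coeff (onesExp n) := by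
    clear hQ heval hP
    induction P using MvPolynomial.induction_on' with
    | monomial s c =>
      have h1 : S (monomial s c) = monomial s ((∏ j, (a j : ℚ) ^ s j) * c) := by
        rw [hS, aeval_monomial, Finsupp.prod_fintype _ _ (by simp), algebraMap_eq]
        simp only [mul_pow, Finset.prod_mul_distrib]
        rw [monomial_eq, Finsupp.prod_fintype _ _ (by simp)]
        simp only [map_mul, map_prod, map_pow]
        ring
      rw [h1, coeff_monomial, coeff_monomial]
      split_ifs with h
      · subst h; simp
      · rw [mul_zero]
    | add p q hp hq => rw [map_add, coeff_add, coeff_add, hp, hq, mul_add]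
  have h1 := mixedMultiplicity_eq_coeff hn (fun j => (hI j).pow (ha j)) hQ
  rw [hcoeff, ← mixedMultiplicity_eq_coeff hn hI hP] at h1
  exact_mod_cast h1

/-- The Samuel multiplicity is the mixed multiplicity of a constant tuple. -/
theorem mixedMultiplicity_const (hn : ringKrullDim R = n) (hn0 : 0 < n) {I : Ideal R}
    (hI : IsMPrimary I) : mixedMultiplicity (fun _ : Fin n => I) = samuelMultiplicity n I := by
  obtain ⟨P, ⟨K, hK⟩, -, -⟩ := exists_mixedHilbertPolynomial_degLT hn (𝓘 := fun _ : Unit => I)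
    fun _ => hI
  set p : Polynomial ℚ := aeval (fun _ => Polynomial.X) P with hp
  have hpeval : ∀ x : ℚ, p.eval x = eval (fun _ => x) P := by
    intro x
    have h := eval_alongRay (fun _ => 1) x P
    simpa [alongRay] using h
  have hsam : IsSamuelPolynomial I p := by
    refine ⟨K, fun k hk => ?_⟩
    have := hK (fun _ => k) fun _ => hk
    rw [hpeval, ← evalNat, this, mixedHilbertFn, mpow]
    simp
  have huniq : ∀ q, IsSamuelPolynomial I q → q = p := by
    rintro q ⟨K', hK'⟩
    obtain ⟨K₁, hK₁⟩ := hsam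
    refine Polynomial.eq_of_infinite_eval_eq _ _ (Set.Infinite.mono ?_
      ((Set.Ici_infinite (max K' K₁)).image (Nat.cast_injective (R := ℚ)).injOn))
    rintro _ ⟨k, hk, rfl⟩
    exact (hK' k ((le_max_left _ _).trans hk)).trans (hK₁ k ((le_max_right _ _).trans hk)).symm
  -- The colength of `∏ I^(k j)` depends only on `∑ k`, and the coefficient of `x_1 ⋯ x_n` in `(∑
  -- x)^n` is `n!`. A nonempty index set is needed to make `∑ k` large.
  have hmix : EventuallyEval (mixedHilbertFn fun _ : Fin n => I)
      (Polynomial.aeval (∑ i, X i : MvPolynomial (Fin n) ℚ) p) := by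
    obtain ⟨K₁, hK₁⟩ := hsam
    refine ⟨K₁, fun k hk => ?_⟩
    have h1 : evalNat (Polynomial.aeval (∑ i, X i : MvPolynomial (Fin n) ℚ) p) k
        = p.eval ((∑ i, k i : ℕ) : ℚ) := by
      have := Polynomial.aeval_algHom_apply (MvPolynomial.aeval (fun i => (k i : ℚ)) :
        MvPolynomial (Fin n) ℚ →ₐ[ℚ] ℚ) (∑ i, X i) p
      rw [map_sum] at this
      simp only [MvPolynomial.aeval_X] at this
      rw [evalNat, ← MvPolynomial.coe_aeval_eq_eval]
      simp only [RingHom.coe_coe]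
      rw [← this, Polynomial.coe_aeval_eq_eval, Nat.cast_sum]
    rw [h1, hK₁ _ ((hk ⟨0, hn0⟩).trans (Finset.single_le_sum (f := k) (fun _ _ => Nat.zero_le _)
      (Finset.mem_univ _))), mixedHilbertFn, mpow, Finset.prod_pow_eq_pow_sum]
  have hcoeff : coeff (onesExp n) (Polynomial.aeval (∑ i, X i : MvPolynomial (Fin n) ℚ) p)
      = n.factorial * p.coeff n := by
    have hsum : ((onesExp n).sum fun _ m => m) = n := by
      rw [Finsupp.sum_fintype _ _ (by simp)]
      simp
    have hmult : (onesExp n).multinomial = n.factorial := by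
      rw [Finsupp.multinomial, show ((onesExp n).sum fun _ => id) = n from hsum, Finsupp.prod_fintype _ _ (by simp)]
      simp
    rw [Polynomial.aeval_eq_sum_range, coeff_sum]
    simp only [coeff_smul, coeff_sum_X_pow_of_fintype, hsum, hmult, smul_eq_mul]
    rw [Finset.sum_eq_single n]
    · rw [if_pos rfl, mul_comm]
    · intro b _ hb
      rw [if_neg (Ne.symm hb)]
      simp
    · intro hb
      rw [Finset.mem_range, not_lt] at hb
      rw [Polynomial.coeff_eq_zero_of_natDegree_lt (by omega), zero_mul]
  have hmm := mixedMultiplicity_eq_coeff hn (fun _ => hI) hmix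
  rw [hcoeff] at hmm
  have hset : {e : ℕ | ∃ P : Polynomial ℚ, IsSamuelPolynomial I P ∧
      (n.factorial : ℚ) * P.coeff n = (e : ℚ)} = {mixedMultiplicity fun _ : Fin n => I} := by
    ext e
    constructor
    · rintro ⟨q, hq, he⟩
      rw [huniq q hq, ← hmm] at he
      exact_mod_cast he.symm
    · rintro rfl
      exact ⟨p, hsam, hmm.symm⟩
  rw [samuelMultiplicity, hset, csInf_singleton]

end Properties

/-! ### Rees' multiplicity and the numbers `r` for `𝔪`-primary ideals -/

section ReesMultiplicity

variable {R : Type*} [CommRing R] [IsLocalRing R] {n : ℕ}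

lemma IsMPrimary.add_pow {I : Ideal R} (hI : IsMPrimary I) {r : ℕ} (hr : 1 ≤ r) :
    IsMPrimary (I + maximalIdeal R ^ r) :=
  hI.sup (isMPrimary_maximalIdeal.pow hr)

lemma lojExponent_le (I : Fin n → Ideal R) (s : ℕ+) :
    lojExponent I ≤ (rNumber (fun j => I j ^ (s : ℕ)) : ℝ) / ((s : ℕ) : ℝ) :=
  ciInf_le ⟨0, by rintro _ ⟨s, rfl⟩; positivity⟩ s

/-- The infimum need not be known to be attained; closed conditions satisfied by all terms still
pass to it. -/
lemma lojExponent_mem_closure (I : Fin n → Ideal R) :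
    lojExponent I ∈ closure (Set.range fun s : ℕ+ =>
      (rNumber (fun j => I j ^ (s : ℕ)) : ℝ) / ((s : ℕ) : ℝ)) :=
  csInf_mem_closure (Set.range_nonempty _) ⟨0, by rintro _ ⟨s, rfl⟩; positivity⟩

variable [IsNoetherianRing R]

/-- Once `𝔪^r` lies in every `I j`, adding it changes nothing; for other `r` monotonicity gives the
upper bound. -/
lemma reesMixedMultiplicity_eq (hn : ringKrullDim R = n) {I : Fin n → Ideal R}
    (hI : ∀ j, IsMPrimary (I j)) : reesMixedMultiplicity I = mixedMultiplicity I := by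
  refine le_antisymm (iSup_le fun r => ?_) ?_
  · exact Nat.cast_le.2 (mixedMultiplicity_anti hn hI (fun j => (hI j).add_pow r.2)
      fun j => le_sup_left)
  · obtain ⟨c, hc⟩ := exists_uniform_pow_le hI
    refine le_trans (le_of_eq ?_) (le_iSup _ (⟨c + 1, Nat.succ_pos c⟩ : ℕ+))
    congr 2
    funext j
    exact (sup_eq_left.2 ((Ideal.pow_le_pow_right (Nat.le_succ c)).trans (hc j))).symm

lemma rNumber_spec (hn : ringKrullDim R = n) {I : Fin n → Ideal R}
    (hI : ∀ j, IsMPrimary (I j)) : 1 ≤ rNumber I ∧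
      mixedMultiplicity (fun j => I j + maximalIdeal R ^ rNumber I) = mixedMultiplicity I := by
  obtain ⟨c, hc⟩ := exists_uniform_pow_le hI
  have hne : {r : ℕ | 1 ≤ r ∧ reesMixedMultiplicity I
      = (mixedMultiplicity (fun j => I j + maximalIdeal R ^ r) : ℕ∞)}.Nonempty := by
    refine ⟨c + 1, Nat.succ_pos c, ?_⟩
    rw [reesMixedMultiplicity_eq hn hI]
    congr 2
    funext j
    exact (sup_eq_left.2 ((Ideal.pow_le_pow_right (Nat.le_succ c)).trans (hc j))).symm
  have h1 : 1 ≤ rNumber I := (Nat.sInf_mem hne).1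
  have h2 : reesMixedMultiplicity I
      = (mixedMultiplicity (fun j => I j + maximalIdeal R ^ rNumber I) : ℕ∞) :=
    (Nat.sInf_mem hne).2
  rw [reesMixedMultiplicity_eq hn hI] at h2
  exact ⟨h1, (Nat.cast_inj.1 h2).symm⟩

lemma rNumber_le (hn : ringKrullDim R = n) {I : Fin n → Ideal R}
    (hI : ∀ j, IsMPrimary (I j)) {r : ℕ} (hr : 1 ≤ r)
    (h : mixedMultiplicity (fun j => I j + maximalIdeal R ^ r) = mixedMultiplicity I) :
    rNumber I ≤ r :=
  Nat.sInf_le ⟨hr, by rw [reesMixedMultiplicity_eq hn hI, h]⟩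

end ReesMultiplicity

/-! ### Asymptotic comparison of powers of `I^a + 𝔪^b` -/

section Powers

lemma sup_pow_le {R : Type*} [CommRing R] {A B C : Ideal R} {u w : ℕ}
    (h : ∀ k ≤ u, A ^ k * B ^ (u - k) ≤ C ^ w) : (A + B) ^ u ≤ C ^ w := by
  rw [_root_.add_pow]
  refine Finset.sum_induction _ (· ≤ C ^ w) (fun _ _ h1 h2 => sup_le h1 h2) bot_le fun k hk => ?_
  exact Ideal.mul_le_left.trans (h k (Nat.lt_succ_iff.1 (Finset.mem_range.1 hk)))

/-- Powers of `I ^ a + 𝔪 ^ b` against powers of `I ^ s + 𝔪 ^ r` if `b / a ≤ r / s`. -/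
lemma add_pow_le_add_pow {R : Type*} [CommRing R] {A B : Ideal R} {a b r s : ℕ} (hs : 1 ≤ s) (hr : 1 ≤ r)
    (h : b * s ≤ r * a) (v : ℕ) :
    (A ^ a + B ^ b) ^ (r * v) ≤ (A ^ s + B ^ r) ^ (b * v - 2) := by
  refine sup_pow_le fun k hk => ?_
  -- The term `A^(ak) B^(b(rv-k))` lies in the power `α + γ` of `A^s + B^r`. Without rounding this
  -- exponent would be at least `bk/r + b(rv-k)/r = bv`; each floor loses less than one, hence the
  -- `2`.
  set α := a * k / s
  set γ := b * (r * v - k) / r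
  have h1 : a * k < s * (α + 1) := Nat.lt_mul_div_succ _ hs
  have h2 : b * (r * v - k) < r * (γ + 1) := Nat.lt_mul_div_succ _ hr
  have h3 : b * k < r * (α + 1) := by
    have h4 : s * (b * k) < s * (r * (α + 1)) := by
      calc s * (b * k) = b * s * k := by ring
        _ ≤ r * a * k := Nat.mul_le_mul_right k h
        _ = r * (a * k) := by ring
        _ < r * (s * (α + 1)) := Nat.mul_lt_mul_of_pos_left h1 hr
        _ = s * (r * (α + 1)) := by ring
    exact Nat.lt_of_mul_lt_mul_left h4
  have h5 : b * v < α + γ + 2 := by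
    have h6 : r * (b * v) < r * (α + γ + 2) := by
      calc r * (b * v) = b * (k + (r * v - k)) := by rw [Nat.add_sub_cancel' hk]; ring
        _ = b * k + b * (r * v - k) := by ring
        _ < r * (α + 1) + r * (γ + 1) := Nat.add_lt_add h3 h2
        _ = r * (α + γ + 2) := by ring
    exact Nat.lt_of_mul_lt_mul_left h6
  calc (A ^ a) ^ k * (B ^ b) ^ (r * v - k)
      = A ^ (a * k) * B ^ (b * (r * v - k)) := by rw [pow_mul, pow_mul]
    _ ≤ A ^ (s * α) * B ^ (r * γ) := Ideal.mul_mono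
        (Ideal.pow_le_pow_right (Nat.mul_div_le _ _)) (Ideal.pow_le_pow_right (Nat.mul_div_le _ _))
    _ = (A ^ s) ^ α * (B ^ r) ^ γ := by rw [pow_mul, pow_mul]
    _ ≤ (A ^ s + B ^ r) ^ α * (A ^ s + B ^ r) ^ γ := Ideal.mul_mono
        (Ideal.pow_right_mono le_sup_left _) (Ideal.pow_right_mono le_sup_right _)
    _ = (A ^ s + B ^ r) ^ (α + γ) := (pow_add _ _ _).symm
    _ ≤ _ := Ideal.pow_le_pow_right (Nat.sub_le_of_le_add (by linarith))

/-- Divide by `v^i` and let `v → ∞`; the loss of `2` disappears. The bound `3 ≤ v` keeps the natural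
subtraction from truncating. -/
lemma pow_mul_le_of_forall {b r i : ℕ} {X Y : ℕ} (hb : 1 ≤ b)
    (h : ∀ v : ℕ, 3 ≤ v → (b * v - 2) ^ i * X ≤ (r * v) ^ i * Y) :
    (b : ℝ) ^ i * X ≤ (r : ℝ) ^ i * Y := by
  have ht : Filter.Tendsto (fun v : ℕ => ((b : ℝ) - 2 / v) ^ i * X) Filter.atTop
      (nhds (((b : ℝ) - 0) ^ i * X)) :=
    ((tendsto_const_nhds.sub (tendsto_const_div_atTop_nhds_zero_nat 2)).pow i).mul_const _
  rw [sub_zero] at ht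
  refine le_of_tendsto ht ?_
  filter_upwards [Filter.eventually_ge_atTop 3] with v hv
  have hv0 : (0 : ℝ) < v := by exact_mod_cast (by omega : 0 < v)
  have hbv : 2 ≤ b * v := by nlinarith
  have h1 : (((b * v - 2 : ℕ) : ℝ)) ^ i * X ≤ ((r : ℝ) * v) ^ i * Y := by exact_mod_cast h v hv
  rw [Nat.cast_sub hbv] at h1
  push_cast at h1
  have h2 : (b : ℝ) - 2 / v = (b * v - 2) / v := by field_simp
  rw [h2, div_pow, div_mul_eq_mul_div, div_le_iff₀ (by positivity)]
  calc _ ≤ _ := h1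
    _ = _ := by rw [mul_pow]; ring

end Powers

/-! ### The numbers `e_i(I)` and the exponents `𝓛₀⁽ⁱ⁾(I)` -/

section MixedMult

variable {R : Type*} [CommRing R] [IsLocalRing R] {n i : ℕ} {I J : Ideal R}

lemma mixedTuple_of_lt {j : Fin n} (h : (j : ℕ) < i) : mixedTuple n i I j = I := if_pos h

lemma mixedTuple_of_le {j : Fin n} (h : i ≤ (j : ℕ)) :
    mixedTuple n i I j = maximalIdeal R := if_neg (not_lt.2 h)

lemma IsMPrimary.mixedTuple (hI : IsMPrimary I) (j : Fin n) :
    IsMPrimary (mixedTuple n i I j) := by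
  unfold MixedLoj.mixedTuple
  split_ifs
  · exact hI
  · exact isMPrimary_maximalIdeal

variable [IsNoetherianRing R]

lemma mixedMult_anti (hn : ringKrullDim R = n) (hI : IsMPrimary I) (hJ : IsMPrimary J)
    (h : I ≤ J) : mixedMult n i J ≤ mixedMult n i I := by
  refine mixedMultiplicity_anti hn (fun j => hI.mixedTuple j) (fun j => hJ.mixedTuple j) fun j => ?_
  unfold mixedTuple
  split_ifs
  · exact h
  · exact le_rfl

lemma mixedMult_mono (hn : ringKrullDim R = n) (hI : IsMPrimary I) {i i' : ℕ} (h : i ≤ i') :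
    mixedMult n i I ≤ mixedMult n i' I := by
  refine mixedMultiplicity_anti hn (fun j => hI.mixedTuple j) (fun j => hI.mixedTuple j) fun j => ?_
  rcases lt_or_ge (j : ℕ) i with h1 | h1
  · rw [mixedTuple_of_lt h1, mixedTuple_of_lt (h1.trans_le h)]
  · rw [mixedTuple_of_le h1]
    exact (hI.mixedTuple j).le

lemma mixedMult_zero (hn : ringKrullDim R = n) (hn0 : 0 < n) :
    mixedMult n 0 I = samuelMultiplicity n (maximalIdeal R) := by
  rw [← mixedMultiplicity_const hn hn0 isMPrimary_maximalIdeal, mixedMult]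
  congr 1

lemma mixedMult_self (hn : ringKrullDim R = n) (hn0 : 0 < n) (hI : IsMPrimary I) :
    mixedMult n n I = samuelMultiplicity n I := by
  rw [← mixedMultiplicity_const hn hn0 hI, mixedMult]
  congr 1
  funext j
  exact mixedTuple_of_lt j.2

lemma prod_ite_lt (hi : i ≤ n) (a b : ℕ) :
    ∏ j : Fin n, (if (j : ℕ) < i then a else b) = a ^ i * b ^ (n - i) := by
  rw [Fin.prod_univ_eq_prod_range (fun j => if j < i then a else b) n,
    ← Nat.add_sub_cancel' hi, Finset.prod_range_add, Nat.add_sub_cancel_left]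
  congr 1
  · rw [Finset.prod_congr rfl fun j hj => if_pos (Finset.mem_range.1 hj)]
    simp
  · simp

lemma mixedMult_pow (hn : ringKrullDim R = n) (hi : i ≤ n) (hI : IsMPrimary I) {a : ℕ}
    (ha : 1 ≤ a) : mixedMult n i (I ^ a) = a ^ i * mixedMult n i I := by
  have h := mixedMultiplicity_pow hn (fun j => hI.mixedTuple (i := i) j)
    (a := fun j => if (j : ℕ) < i then a else 1) (fun j => by split_ifs <;> omega)
  rw [prod_ite_lt hi, one_pow, mul_one] at h
  rw [mixedMult, mixedMult, ← h]
  congr 1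
  funext j
  unfold mixedTuple
  split_ifs
  · rfl
  · rw [pow_one]

/-- The tuple `(I ^ s + 𝔪 ^ r, …, 𝔪 ^ s + 𝔪 ^ r)` for `s ≤ r`. -/
lemma mixedMultiplicity_tuple_pow_add (hn : ringKrullDim R = n) (hi : i ≤ n) (hI : IsMPrimary I)
    {s r : ℕ} (hs : 1 ≤ s) (hsr : s ≤ r) :
    mixedMultiplicity (fun j => mixedTuple n i I j ^ s + maximalIdeal R ^ r)
      = s ^ (n - i) * mixedMult n i (I ^ s + maximalIdeal R ^ r) := by
  have h := mixedMultiplicity_pow hn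
    (fun j => ((hI.pow hs).add_pow (hs.trans hsr)).mixedTuple (i := i) j)
    (a := fun j => if (j : ℕ) < i then 1 else s) (fun j => by split_ifs <;> omega)
  rw [prod_ite_lt hi, one_pow, one_mul] at h
  rw [mixedMult, ← h]
  congr 1
  funext j
  unfold mixedTuple
  split_ifs
  · rw [pow_one]
  · exact sup_eq_left.2 (Ideal.pow_le_pow_right hsr)

lemma mixedMultiplicity_tuple_pow (hn : ringKrullDim R = n) (hI : IsMPrimary I) {s : ℕ}
    (hs : 1 ≤ s) :
    mixedMultiplicity (fun j => mixedTuple n i I j ^ s) = s ^ n * mixedMult n i I := by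
  rw [mixedMultiplicity_pow hn (fun j => hI.mixedTuple j) fun _ => hs]
  simp [mixedMult]

lemma one_le_mixedMult (hn : ringKrullDim R = n) (hn0 : 0 < n)
    (hm : samuelMultiplicity n (maximalIdeal R) = 1) (hI : IsMPrimary I) (i : ℕ) :
    1 ≤ mixedMult n i I := by
  rw [← hm, ← mixedMult_zero (I := I) hn hn0]
  exact mixedMult_mono hn hI (Nat.zero_le i)

/-- The basic inequality: if `r` is the number `r(I ^ s, …, I ^ s, 𝔪 ^ s, …, 𝔪 ^ s)`, then
`s e_{i+1}(I) ≤ r e_i(I)`. -/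
lemma mul_mixedMult_le_rNumber_mul (hn : ringKrullDim R = n) (hi : i < n) (hI : IsMPrimary I)
    {s : ℕ} (hs : 1 ≤ s) : s * mixedMult n (i + 1) I
      ≤ rNumber (fun j => mixedTuple n (i + 1) I j ^ s) * mixedMult n i I := by
  obtain ⟨hr, hrs⟩ := rNumber_spec hn fun j => (hI.mixedTuple (n := n) (i := i + 1) j).pow hs
  set r := rNumber fun j => mixedTuple n (i + 1) I j ^ s
  rw [mixedMultiplicity_tuple_pow hn hI hs] at hrs
  set j₀ : Fin n := ⟨i, hi⟩
  have ha : ∀ j : Fin n, 1 ≤ if j = j₀ then r else s := fun j => by split_ifs <;> assumption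
  have hpow := mixedMultiplicity_pow hn (fun j => hI.mixedTuple (i := i) j) ha
  -- The comparison tuple has `𝔪^r` at position `i`, inside `I^s + 𝔪^r`; every other entry is the
  -- `s`-th power already present.
  have hle := mixedMultiplicity_anti hn (fun j => (hI.mixedTuple (i := i) j).pow (ha j))
    (fun j => ((hI.mixedTuple (n := n) (i := i + 1) j).pow hs).add_pow hr) (fun j => by
      by_cases hj : j = j₀
      · rw [if_pos hj, hj, mixedTuple_of_le (j := j₀) le_rfl]
        exact le_sup_right
      · rw [if_neg hj]
        refine le_trans (le_of_eq ?_) le_sup_left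
        have hj' : (j : ℕ) ≠ i := fun h => hj (Fin.ext h)
        rcases lt_or_ge (j : ℕ) i with h | h
        · rw [mixedTuple_of_lt h, mixedTuple_of_lt (h.trans (Nat.lt_succ_self i))]
        · rw [mixedTuple_of_le h, mixedTuple_of_le (by omega)])
  have hprod : ∏ j : Fin n, (if j = j₀ then r else s) = r * s ^ (n - 1) := by
    rw [← Finset.mul_prod_erase _ _ (Finset.mem_univ j₀), if_pos rfl,
      Finset.prod_congr rfl fun j hj => if_neg (Finset.ne_of_mem_erase hj)]
    simp
  rw [hrs, hpow, hprod, ← mixedMult, mul_right_comm,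
    show s ^ n = s * s ^ (n - 1) by rw [← pow_succ', Nat.sub_add_cancel (by omega)],
    mul_right_comm s] at hle
  exact Nat.le_of_mul_le_mul_right hle (by positivity)

lemma div_le_lojExp (hn : ringKrullDim R = n) (hi : i < n) (hI : IsMPrimary I)
    (hpos : 1 ≤ mixedMult n i I) :
    (mixedMult n (i + 1) I : ℝ) / mixedMult n i I ≤ lojExp n (i + 1) I := by
  refine le_ciInf fun s => ?_
  have hpos' : (0 : ℝ) < mixedMult n i I := Nat.cast_pos.2 hpos
  have hs : (0 : ℝ) < (s : ℕ) := Nat.cast_pos.2 s.2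
  rw [div_le_div_iff₀ hpos' hs, mul_comm]
  exact_mod_cast mul_mixedMult_le_rNumber_mul hn hi hI s.2

/-- By definition of `r`, `e_{i+1}(I^s + 𝔪^r) = s^{i+1} e_{i+1}(I)`. The basic inequality is exactly
the slope condition `b s ≤ r a` for comparing powers of `I^a + 𝔪^b` with powers of `I^s + 𝔪^r`. -/
lemma pow_mul_mixedMult_le (hn : ringKrullDim R = n) (hi : i < n) (hI : IsMPrimary I)
    (hpos : 1 ≤ mixedMult n i I) {s : ℕ} (hs : 1 ≤ s) :
    ((mixedMult n (i + 1) I : ℝ) * s) ^ (i + 1) * mixedMult n (i + 1) I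
      ≤ (rNumber (fun j => mixedTuple n (i + 1) I j ^ s) : ℝ) ^ (i + 1) *
        mixedMult n (i + 1)
          (I ^ mixedMult n i I + maximalIdeal R ^ mixedMult n (i + 1) I) := by
  have hmul := mul_mixedMult_le_rNumber_mul hn hi hI hs
  obtain ⟨hr, hrs⟩ := rNumber_spec hn fun j => (hI.mixedTuple (n := n) (i := i + 1) j).pow hs
  set r := rNumber fun j => mixedTuple n (i + 1) I j ^ s
  have hab : mixedMult n i I ≤ mixedMult n (i + 1) I := mixedMult_mono hn hI (Nat.le_succ i)
  set a := mixedMult n i I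
  set b := mixedMult n (i + 1) I with hb
  -- Needed so that `𝔪^s + 𝔪^r = 𝔪^s` in the last entries.
  have hsr : s ≤ r :=
    Nat.le_of_mul_le_mul_right ((Nat.mul_le_mul_left s hab).trans hmul) hpos
  rw [mixedMultiplicity_tuple_pow hn hI hs, mixedMultiplicity_tuple_pow_add hn hi hI hs hsr,
    show s ^ n = s ^ (n - (i + 1)) * s ^ (i + 1) by rw [← pow_add]; congr 1; omega,
    mul_assoc] at hrs
  have hE := Nat.eq_of_mul_eq_mul_left (by positivity) hrs
  have key := pow_mul_le_of_forall (b := b) (r := r) (i := i + 1) (X := s ^ (i + 1) * b)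
    (Y := mixedMult n (i + 1) (I ^ a + maximalIdeal R ^ b)) (hpos.trans hab) (fun v hv => by
      have hbv : 1 ≤ b * v - 2 := by
        have : 1 * 3 ≤ b * v := Nat.mul_le_mul (hpos.trans hab) hv
        omega
      have hrv : 1 ≤ r * v := Nat.mul_pos hr (by omega)
      have p1 := (hI.pow hs).add_pow (R := R) hr
      have p2 := (hI.pow hpos).add_pow (R := R) (hpos.trans hab)
      have h1 := mixedMult_anti (i := i + 1) hn (p2.pow hrv) (p1.pow hbv)
        (add_pow_le_add_pow hs hr (by linarith) v)
      rwa [mixedMult_pow hn hi p1 hbv, mixedMult_pow hn hi p2 hrv, hE] at h1)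
  rw [mul_pow, mul_assoc]
  exact_mod_cast key

lemma pow_mul_mixedMult_le_lojExp (hn : ringKrullDim R = n) (hi : i < n) (hI : IsMPrimary I)
    (hpos : 1 ≤ mixedMult n i I) :
    (mixedMult n (i + 1) I : ℝ) ^ (i + 1) * mixedMult n (i + 1) I
      ≤ lojExp n (i + 1) I ^ (i + 1) * mixedMult n (i + 1)
          (I ^ mixedMult n i I + maximalIdeal R ^ mixedMult n (i + 1) I) := by
  have hclosed : IsClosed {x : ℝ | (mixedMult n (i + 1) I : ℝ) ^ (i + 1) * mixedMult n (i + 1) I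
      ≤ x ^ (i + 1) * mixedMult n (i + 1)
          (I ^ mixedMult n i I + maximalIdeal R ^ mixedMult n (i + 1) I)} :=
    isClosed_le continuous_const (by fun_prop)
  refine closure_minimal ?_ hclosed (lojExponent_mem_closure (mixedTuple n (i + 1) I))
  rintro _ ⟨s, rfl⟩
  have hs : (0 : ℝ) < (s : ℕ) := Nat.cast_pos.2 s.2
  have h := pow_mul_mixedMult_le hn hi hI hpos s.2
  rw [Set.mem_ofPred_eq, div_pow, div_mul_eq_mul_div, le_div_iff₀ (by positivity)]
  rwa [mul_pow, mul_right_comm] at h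

lemma mixedMult_eq_of_lojExp_eq (hn : ringKrullDim R = n) (hi : i < n) (hI : IsMPrimary I)
    (hpos : 1 ≤ mixedMult n i I)
    (h : lojExp n (i + 1) I = (mixedMult n (i + 1) I : ℝ) / mixedMult n i I) :
    mixedMult n i I ^ (i + 1) * mixedMult n (i + 1) I = mixedMult n (i + 1)
      (I ^ mixedMult n i I + maximalIdeal R ^ mixedMult n (i + 1) I) := by
  have hab : mixedMult n i I ≤ mixedMult n (i + 1) I := mixedMult_mono hn hI (Nat.le_succ i)
  refine le_antisymm ?_ ?_
  · have key := pow_mul_mixedMult_le_lojExp hn hi hI hpos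
    rw [h] at key
    set E := mixedMult n (i + 1) (I ^ mixedMult n i I + maximalIdeal R ^ mixedMult n (i + 1) I)
    have ha : (0 : ℝ) < mixedMult n i I := Nat.cast_pos.2 hpos
    have hb : (0 : ℝ) < mixedMult n (i + 1) I := Nat.cast_pos.2 (hpos.trans hab)
    rw [div_pow, div_mul_eq_mul_div, le_div_iff₀ (by positivity), mul_assoc] at key
    have key' := le_of_mul_le_mul_left key (by positivity)
    rw [mul_comm]
    exact_mod_cast key'
  · rw [← mixedMult_pow hn hi hI hpos]
    exact mixedMult_anti hn (hI.pow hpos) ((hI.pow hpos).add_pow (hpos.trans hab)) le_sup_left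

lemma lojExp_eq_of_mixedMult_eq (hn : ringKrullDim R = n) (hi : i < n) (hI : IsMPrimary I)
    (hpos : 1 ≤ mixedMult n i I)
    (h : mixedMult n i I ^ (i + 1) * mixedMult n (i + 1) I = mixedMult n (i + 1)
      (I ^ mixedMult n i I + maximalIdeal R ^ mixedMult n (i + 1) I)) :
    lojExp n (i + 1) I = (mixedMult n (i + 1) I : ℝ) / mixedMult n i I := by
  have hab : mixedMult n i I ≤ mixedMult n (i + 1) I := mixedMult_mono hn hI (Nat.le_succ i)
  refine le_antisymm ?_ (div_le_lojExp hn hi hI hpos)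
  -- Taking `s = e_i`, the hypothesis says that adding `𝔪^(e_{i+1})` leaves the multiplicity
  -- unchanged.
  refine (lojExponent_le _ ⟨mixedMult n i I, hpos⟩).trans ?_
  rw [PNat.mk_coe]
  have hr : rNumber (fun j => mixedTuple n (i + 1) I j ^ mixedMult n i I)
      ≤ mixedMult n (i + 1) I := by
    refine rNumber_le hn (fun j => (hI.mixedTuple j).pow hpos) (hpos.trans hab) ?_
    rw [mixedMultiplicity_tuple_pow hn hI hpos,
      mixedMultiplicity_tuple_pow_add hn hi hI hpos hab, ← h, ← mul_assoc, ← pow_add]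
    congr 2
    omega
  gcongr

end MixedMult

lemma samuelMultiplicity_congr_of_eventually {R : Type*} [CommRing R] {I J : Ideal R} (n c : ℕ)
    (h : ∀ k, c ≤ k → I ^ k = J ^ k) : samuelMultiplicity n I = samuelMultiplicity n J := by
  have key : ∀ {I J : Ideal R}, (∀ k, c ≤ k → I ^ k = J ^ k) → ∀ P, IsSamuelPolynomial I P →
      IsSamuelPolynomial J P := by
    rintro I J h P ⟨N, hN⟩
    refine ⟨max N c, fun k hk => ?_⟩
    rw [hN k ((le_max_left _ _).trans hk), h k ((le_max_right _ _).trans hk)]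
  have h' : ∀ P, IsSamuelPolynomial I P ↔ IsSamuelPolynomial J P := fun P =>
    ⟨key h P, key (fun k hk => (h k hk).symm) P⟩
  simp only [samuelMultiplicity, h']

/-- In dimension zero `𝔪` is nilpotent, so large powers of `I` and `𝔪` are both zero. -/
lemma samuelMultiplicity_eq_of_dim_zero {R : Type*} [CommRing R] [IsLocalRing R]
    [IsNoetherianRing R] (hn : ringKrullDim R = 0) {I : Ideal R} (hI : I ≤ maximalIdeal R) (n : ℕ) :
    samuelMultiplicity n I = samuelMultiplicity n (maximalIdeal R) := by
  obtain ⟨c, hc⟩ : ∃ c, maximalIdeal R ^ c = ⊥ := by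
    have : Ring.KrullDimLE 0 R := ringKrullDimZero_iff_ringKrullDim_eq_zero.2 hn
    obtain ⟨c, hc⟩ := (⊥ : Ideal R).exists_radical_pow_le_of_fg (IsNoetherian.noetherian _)
    rw [Ring.KrullDimLE.radical_eq_maximalIdeal ⊥ bot_ne_top] at hc
    exact ⟨c, le_bot_iff.1 hc⟩
  refine samuelMultiplicity_congr_of_eventually n c fun k hk => ?_
  have h1 : maximalIdeal R ^ k = ⊥ := le_bot_iff.1 (hc ▸ Ideal.pow_le_pow_right hk)
  rw [h1]
  exact le_bot_iff.1 (h1 ▸ Ideal.pow_right_mono hI k)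

end MixedLoj

end

/-! ### Telescoping and termwise comparison -/

theorem proposition3p2 {R : Type*} [CommRing R] [IsLocalRing R] [IsNoetherianRing R]
    (n : ℕ) (hn : ringKrullDim R = n)
    (hm : MixedLoj.samuelMultiplicity n (maximalIdeal R) = 1)
    (I : Ideal R) (hI : I.radical = maximalIdeal R) :
    MixedLoj.Li n I ≤ MixedLoj.DP n I ∧
    List.TFAE
      [MixedLoj.Li n I = MixedLoj.DP n I,
       ∀ i ∈ Finset.Icc 1 n, MixedLoj.lojExp n i I =
          (MixedLoj.mixedMult n i I : ℝ) / (MixedLoj.mixedMult n (i - 1) I : ℝ),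
       ∀ i ∈ Finset.Icc 1 n,
          MixedLoj.mixedMult n (i - 1) I ^ i * MixedLoj.mixedMult n i I =
            MixedLoj.mixedMult n i
              (I ^ MixedLoj.mixedMult n (i - 1) I + maximalIdeal R ^ MixedLoj.mixedMult n i I),
       MixedLoj.IsHickel n I] := by
  have hI' := MixedLoj.isMPrimary_of_radical hI
  rcases Nat.eq_zero_or_pos n with rfl | hn0
  -- Dimension zero is separate: the empty tuple does not compute the Samuel multiplicity. All sums
  -- and products are empty, and the Hickel condition reads `e(I) = 1`.
  · have hd : MixedLoj.samuelMultiplicity 0 I = 1 :=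
      (MixedLoj.samuelMultiplicity_eq_of_dim_zero (by simpa using hn) hI'.le 0).trans hm
    refine ⟨by simp [MixedLoj.Li, MixedLoj.DP], List.tfae_of_forall True _ ?_⟩
    simp [MixedLoj.Li, MixedLoj.DP, MixedLoj.IsHickel, hd]
  have hpos : ∀ i, 1 ≤ MixedLoj.mixedMult n i I := fun i =>
    MixedLoj.one_le_mixedMult hn hn0 hm hI' i
  have hpos' : ∀ i, (0 : ℝ) < MixedLoj.mixedMult n i I := fun i => Nat.cast_pos.2 (hpos i)
  have he0 : MixedLoj.mixedMult n 0 I = 1 := (MixedLoj.mixedMult_zero hn hn0).trans hm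
  have hle : ∀ i ∈ Finset.Icc 1 n,
      (MixedLoj.mixedMult n i I : ℝ) / MixedLoj.mixedMult n (i - 1) I ≤ MixedLoj.lojExp n i I := by
    intro i hi
    obtain ⟨h1, h2⟩ := Finset.mem_Icc.1 hi
    obtain ⟨i, rfl⟩ := Nat.exists_eq_add_of_le' h1
    exact MixedLoj.div_le_lojExp hn h2 hI' (hpos _)
  have hq : ∀ i, (0 : ℝ) < (MixedLoj.mixedMult n i I : ℝ) / MixedLoj.mixedMult n (i - 1) I :=
    fun i => div_pos (hpos' _) (hpos' _)
  have hDP : MixedLoj.DP n I = ∑ i ∈ Finset.Icc 1 n,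
      1 / ((MixedLoj.mixedMult n i I : ℝ) / MixedLoj.mixedMult n (i - 1) I) := by
    refine Finset.sum_congr rfl fun i _ => ?_
    rw [one_div_div]
    congr 1
    split_ifs with h
    · rw [h, Nat.sub_self, he0, Nat.cast_one]
    · rfl
  have hterm : ∀ i ∈ Finset.Icc 1 n, 1 / MixedLoj.lojExp n i I
      ≤ 1 / ((MixedLoj.mixedMult n i I : ℝ) / MixedLoj.mixedMult n (i - 1) I) := fun i hi =>
    one_div_le_one_div_of_le (hq i) (hle i hi)
  have hprod : (MixedLoj.samuelMultiplicity n I : ℝ) = ∏ i ∈ Finset.Icc 1 n,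
      (MixedLoj.mixedMult n i I : ℝ) / MixedLoj.mixedMult n (i - 1) I := by
    -- The product of ratios telescopes, starting from `e_0 = e(𝔪) = 1`.
    have key : ∀ m : ℕ, (MixedLoj.mixedMult n m I : ℝ) = ∏ i ∈ Finset.Icc 1 m,
        (MixedLoj.mixedMult n i I : ℝ) / MixedLoj.mixedMult n (i - 1) I := by
      intro m
      induction m with
      | zero => simp [he0]
      | succ m ih =>
        rw [Finset.prod_Icc_succ_top (by omega), ← ih, Nat.add_sub_cancel,
          mul_div_cancel₀ _ (hpos' m).ne']
    rw [← key n, MixedLoj.mixedMult_self hn hn0 hI']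
  refine ⟨hDP ▸ Finset.sum_le_sum hterm, ?_⟩
  tfae_have 1 ↔ 2 := by
    rw [hDP, MixedLoj.Li, Finset.sum_eq_sum_iff_of_le hterm]
    refine forall₂_congr fun i _ => ?_
    rw [one_div, one_div, inv_inj]
  tfae_have 2 ↔ 3 := by
    refine forall₂_congr fun i hi => ?_
    obtain ⟨h1, h2⟩ := Finset.mem_Icc.1 hi
    obtain ⟨i, rfl⟩ := Nat.exists_eq_add_of_le' h1
    exact ⟨MixedLoj.mixedMult_eq_of_lojExp_eq hn h2 hI' (hpos _),
      MixedLoj.lojExp_eq_of_mixedMult_eq hn h2 hI' (hpos _)⟩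
  tfae_have 2 → 4 := fun h => by
    rw [MixedLoj.IsHickel, hprod]
    exact Finset.prod_congr rfl fun i hi => (h i hi).symm
  -- All ratios are positive and bounded by the exponents, so one strict inequality would make the
  -- product of the exponents exceed `e(I)`.
  tfae_have 4 → 2 := fun h i hi => by
    rw [MixedLoj.IsHickel, hprod] at h
    by_contra hne
    exact h.not_lt (Finset.prod_lt_prod (fun i _ => hq i) hle
      ⟨i, hi, lt_of_le_of_ne (hle i hi) (Ne.symm hne)⟩)
  tfae_finish
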